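/- Let $V$ be a complex vector space of dimension $n$ and let $0\le r\le k\le n$, $s\ge 1$. Let $\operatorname{Gr}(k,V)\subset\mathbb P(\bigwedge^k V)$ be the Grassmannian in its Plücker embedding, with $\widehat E=e_1\wedge\cdots\wedge e_k$ for a basis of a $k$-plane $E$. For a projective variety $X\subset \mathbb P W$ let $\sigma_s(X)$ be its $s$-secant variety (the Zariski closure of the set of points in the span of $s$ points of $X$), with virtual dimension $s\dim X+s-1$ and expected dimension $\min\{\dim\mathbb P W,\ s\dim X+s-1\}$. Let $$\sigma_s^r(\operatorname{Gr}(k,V))=\overline{\{[\lambda_1\widehat E_1+\cdots+\lambda_s\widehat E_s] : E_i\in \operatorname{Gr}(k,V),\ \dim(E_1\cap\cdots\cap E_s)\ge r\}}\subset \mathbb P(\textstyle\bigwedge^kV)$$ be the $r$-restricted $s$-secant variety, with virtual dimension $r(n-r)+s(k-r)(n-k)+s-1$. The defect of a (restricted) secant variety is its virtual dimension minus its dimension. Assume the Baur–Draisma–de Graaf conjecture: for $s\ge1$ and $0\le m\le N$ the variety $\sigma_s(\operatorname{Gr}(m,\mathbb C^N))$ has the expected dimension unless, up to the duality $m\leftrightarrow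 N-m$, it is one of $\sigma_s(\operatorname{Gr}(2,N))$ with $s\ge 2$ and $2s+2\le N$, $\sigma_3(\operatorname{Gr}(3,7))$, $\sigma_3(\operatorname{Gr}(4,8))$, $\sigma_4(\operatorname{Gr}(4,8))$, $\sigma_4(\operatorname{Gr}(3,9))$. Then every restricted secant variety can be written with an overlap that cannot be increased: there is $q$ with $r\le q\le k$, $\sigma_s^{q}(\operatorname{Gr}(k,V))=\sigma_s^{r}(\operatorname{Gr}(k,V))$ and $\sigma_s^{q+1}(\operatorname{Gr}(k,V))\ne\sigma_s^{q}(\operatorname{Gr}(k,V))$. If $r$ itself is such an overlap, that is $\sigma_s^{r+1}(\operatorname{Gr}(k,V))\neq\sigma_s^{r}(\operatorname{Gr}(k,V))$, or if $r=0$, then $\sigma_s^r(\operatorname{Gr}(k,V))$ has no defect other than that of the ordinary secant variety: for every $r$-dimensional subspace $E\subset V$, 1. the defect of $\sigma_s^r(\operatorname{Gr}(k,V))$ equals the defect of $\sigma_s(\operatorname{Gr}(k-r,V/E))$; 2. $\dim\sigma_s^r(\operatorname{Gr}(k,V))=\dim\operatorname{Gr}(r,V)+\dim\sigma_s(\operatorname{Gr}(k-r,V/E))=\dim\operatorname{Gr}(r,V)+\dim\sigma_s(\operatorname{Gr}(k-r,\mathbb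 C^{n-r}))$; 3. if $\sigma_s(\operatorname{Gr}(k-r,\mathbb C^{n-r}))$ is not in the above list, then $$\dim\sigma_s^r(\operatorname{Gr}(k,V))=r(n-r)+\min\left\{\tbinom{n-r}{k-r}-1,\ s(k-r)(n-k)+s-1\right\}.$$ -/

import Mathlib

noncomputable section

namespace RestrictedSecant

/-- Polynomial functions on a complex vector space: the algebra of functions generated by the
linear forms. -/
def polyFun (W : Type*) [AddCommGroup W] [Module ℂ W] : Subalgebra ℂ (W → ℂ) :=
  Algebra.adjoin ℂ (Set.range fun φ : Module.Dual ℂ W => (φ : W → ℂ))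

/-- Homogeneous polynomial functions of degree `d`. -/
def IsHomogeneousForm {W : Type*} [AddCommGroup W] [Module ℂ W] (d : ℕ) (f : W → ℂ) : Prop :=
  f ∈ polyFun W ∧ ∀ (c : ℂ) (v : W), f (c • v) = c ^ d * f v

/-- Zariski closure in projective space: the common zeros of all forms vanishing on `X`. -/
def zariskiClosure {W : Type*} [AddCommGroup W] [Module ℂ W] (X : Set (Projectivization ℂ W)) :
    Set (Projectivization ℂ W) :=
  {p | ∀ (d : ℕ) (f : W → ℂ), IsHomogeneousForm d f → (∀ q ∈ X, f q.rep = 0) → f p.rep = 0}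

/-- The affine cone over `X`, including the origin. -/
def affineCone {W : Type*} [AddCommGroup W] [Module ℂ W] (X : Set (Projectivization ℂ W)) :
    Set W :=
  {v | ∀ hv : v ≠ 0, Projectivization.mk ℂ v hv ∈ X}

/-- Restriction of functions to the affine cone over `X`. -/
def restrictToCone {W : Type*} [AddCommGroup W] [Module ℂ W] (X : Set (Projectivization ℂ W)) :
    (W → ℂ) →ₐ[ℂ] (affineCone X → ℂ) where
  toFun f := fun v => f v
  map_one' := rfl
  map_mul' _ _ := rfl
  map_zero' := rfl
  map_add' _ _ := rfl
  commutes' _ := rfl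

/-- The homogeneous coordinate ring of `X`: polynomial functions restricted to the affine cone,
that is, the polynomial ring modulo the ideal of polynomials vanishing on the cone. -/
def homCoordRing {W : Type*} [AddCommGroup W] [Module ℂ W] (X : Set (Projectivization ℂ W)) :
    Subalgebra ℂ (affineCone X → ℂ) :=
  (polyFun W).map (restrictToCone X)

/-- The dimension of a projective variety: the transcendence degree of its homogeneous coordinate
ring (the dimension of the affine cone) minus one. The empty variety has dimension `-1`. -/
def projDim {W : Type*} [AddCommGroup W] [Module ℂ W] (X : Set (Projectivization ℂ W)) : ℤ :=
  (Cardinal.toNat (Algebra.trdeg ℂ (homCoordRing X)) : ℤ) - 1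

/-- `x = e₁ ∧ ⋯ ∧ e_k` for some basis `e₁, …, e_k` of the `k`-dimensional subspace `E`. -/
def IsPluckerRep {V : Type*} [AddCommGroup V] [Module ℂ V] (k : ℕ) (E : Submodule ℂ V)
    (x : ⋀[ℂ]^k V) : Prop :=
  ∃ e : Fin k → V, LinearIndependent ℂ e ∧ Submodule.span ℂ (Set.range e) = E ∧
    x = exteriorPower.ιMulti ℂ k e

/-- The Grassmannian of `k`-dimensional subspaces of `V` in its Plücker embedding. -/
def grassmannian (k : ℕ) (V : Type*) [AddCommGroup V] [Module ℂ V] :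
    Set (Projectivization ℂ (⋀[ℂ]^k V)) :=
  {p | ∃ (E : Submodule ℂ V) (x : ⋀[ℂ]^k V) (hx : x ≠ 0),
    IsPluckerRep k E x ∧ p = Projectivization.mk ℂ x hx}

/-- The `s`-secant variety of `X`: the Zariski closure of the set of points lying in the span of
`s` points of `X`. -/
def secantVariety {W : Type*} [AddCommGroup W] [Module ℂ W] (s : ℕ)
    (X : Set (Projectivization ℂ W)) : Set (Projectivization ℂ W) :=
  zariskiClosure {p | ∃ x : Fin s → Projectivization ℂ W, (∀ i, x i ∈ X) ∧
    p.rep ∈ Submodule.span ℂ (Set.range fun i => (x i).rep)}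

/-- The `r`-restricted `s`-secant variety of the Grassmannian of `k`-planes in `V`: the Zariski
closure of the set of points `[c₁ Ê₁ + ⋯ + c_s Ê_s]` with `dim (E₁ ∩ ⋯ ∩ E_s) ≥ r`. -/
def restrictedSecant (s r k : ℕ) (V : Type*) [AddCommGroup V] [Module ℂ V] :
    Set (Projectivization ℂ (⋀[ℂ]^k V)) :=
  zariskiClosure {p | ∃ (E : Fin s → Submodule ℂ V) (x : Fin s → ⋀[ℂ]^k V) (c : Fin s → ℂ)
    (h : ∑ i, c i • x i ≠ 0), (∀ i, IsPluckerRep k (E i) (x i)) ∧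
      r ≤ Module.finrank ℂ (⨅ i, E i : Submodule ℂ V) ∧ p = Projectivization.mk ℂ _ h}

/-- The virtual dimension `s · dim X + s - 1` of the `s`-secant variety of `X`. -/
def virtualDim {W : Type*} [AddCommGroup W] [Module ℂ W] (s : ℕ)
    (X : Set (Projectivization ℂ W)) : ℤ :=
  s * projDim X + s - 1

/-- The expected dimension of the `s`-secant variety of `X`. -/
def expectedDim {W : Type*} [AddCommGroup W] [Module ℂ W] (s : ℕ)
    (X : Set (Projectivization ℂ W)) : ℤ :=
  min ((Module.finrank ℂ W : ℤ) - 1) (virtualDim s X)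

/-- The defect of the `s`-secant variety of `X`, relative to the virtual dimension. -/
def secantDefect {W : Type*} [AddCommGroup W] [Module ℂ W] (s : ℕ)
    (X : Set (Projectivization ℂ W)) : ℤ :=
  virtualDim s X - projDim (secantVariety s X)

/-- The virtual dimension of the `r`-restricted `s`-secant variety of the Grassmannian of
`k`-planes in `n`-space: an `r`-plane `E`, then `s` planes of dimension `k - r` in the quotient by
`E`, then a point in the span of the resulting `s` points. -/
def restrictedVirtualDim (s r k n : ℕ) : ℤ :=
  (r : ℤ) * ((n : ℤ) - r) + s * (((k : ℤ) - r) * ((n : ℤ) - k)) + s - 1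

/-- The defect of the restricted secant variety, relative to its virtual dimension. -/
def restrictedDefect (s r k : ℕ) (V : Type*) [AddCommGroup V] [Module ℂ V] : ℤ :=
  restrictedVirtualDim s r k (Module.finrank ℂ V) - projDim (restrictedSecant s r k V)

/-- The list of known defective secant varieties `σ_s(Gr(k, n))`, up to the duality
`Gr(k, n) ≅ Gr(n - k, n)`. The varieties `σ_s(Gr(2, n))` (skew-symmetric matrices of rank at most
`2s`) are defective exactly for `2 ≤ s` and `2s + 2 ≤ n`. -/
def InDefectiveList (s k n : ℕ) : Prop :=
  ((k = 2 ∨ n = k + 2) ∧ 2 ≤ s ∧ 2 * s + 2 ≤ n) ∨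
  ((k = 3 ∨ k = 4) ∧ n = 7 ∧ s = 3) ∨
  (k = 4 ∧ n = 8 ∧ (s = 3 ∨ s = 4)) ∨
  ((k = 3 ∨ k = 6) ∧ n = 9 ∧ s = 4)

/-- The Baur–Draisma–de Graaf conjecture: outside the list, every secant variety of a Grassmannian
has the expected dimension. -/
def BDdGConjecture : Prop :=
  ∀ s k n : ℕ, 1 ≤ s → k ≤ n → ¬ InDefectiveList s k n →
    projDim (secantVariety s (grassmannian k (Fin n → ℂ))) =
      expectedDim s (grassmannian k (Fin n → ℂ))

end RestrictedSecant

end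

/-!
Choose a splitting `V ≅ ℂ^r × U`. Over the affine chart of `Gr(r, V)` given by the graphs of linear
maps `ℂ^r → U`, a point of the affine cone over the restricted secant variety is a multivector
`ω = e₁ ∧ ⋯ ∧ e_r ∧ η`, where `e` is the graph frame and `η` lies in the affine cone over
`σ_s(Gr(k - r, U))`. So the cone is dominated by the product of the chart with the cone of `η`s, and
the whole statement says that this parametrization is generically finite. The cofactor `η` is
recovered from `ω` by contraction along `ℂ^r`. The `r`-plane is recovered as the annihilator
`{v | v ∧ ω = 0}` as soon as one `ω` has an annihilator of dimension only `r`: its coordinates then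
solve a linear system with coefficients linear in `ω`, hence are algebraic by Cramer's rule.
Such an `ω` exists when the overlap is maximal, because a vector of the annihilator outside the
`r`-plane can be split off every summand of `ω`, raising the overlap to `r + 1`.
Dimensions are transcendence degrees of rings of polynomial functions pulled back along
parametrizations, so that no closure has to be computed.
-/

noncomputable section

namespace RestrictedSecant

open ExteriorAlgebra

section PolyFun

variable {W W' W'' : Type*} [AddCommGroup W] [Module ℂ W] [AddCommGroup W'] [Module ℂ W']
  [AddCommGroup W''] [Module ℂ W'']

lemma dual_mem_polyFun (φ : Module.Dual ℂ W) : (φ : W → ℂ) ∈ polyFun W :=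
  Algebra.subset_adjoin ⟨φ, rfl⟩

lemma exists_polynomial_of_mem_polyFun {F : W → ℂ} (hF : F ∈ polyFun W) (p v : W) :
    ∃ h : Polynomial ℂ, ∀ t : ℂ, F (p + t • v) = h.eval t := by
  induction hF using Algebra.adjoin_induction with
  | mem x hx =>
    obtain ⟨φ, rfl⟩ := hx
    exact ⟨Polynomial.C (φ p) + Polynomial.C (φ v) * Polynomial.X, fun t => by simp [mul_comm t]⟩
  | algebraMap c => exact ⟨Polynomial.C c, fun t => by simp⟩
  | add x y _ _ hx hy =>
    obtain ⟨⟨f, hf⟩, g, hg⟩ := hx, hy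
    exact ⟨f + g, fun t => by simp [hf, hg]⟩
  | mul x y _ _ hx hy =>
    obtain ⟨⟨f, hf⟩, g, hg⟩ := hx, hy
    exact ⟨f * g, fun t => by simp [hf, hg]⟩

/-- Two points where `F` and `G` do not vanish are joined by a line, on which `F` and `G` are
polynomials in one variable. -/
instance : NoZeroDivisors (polyFun W) where
  eq_zero_or_eq_zero_of_mul_eq_zero {F G} h := by
    by_contra! hne
    obtain ⟨p, hp⟩ := Function.ne_iff.1 (Subtype.coe_ne_coe.2 hne.1)
    obtain ⟨q, hq⟩ := Function.ne_iff.1 (Subtype.coe_ne_coe.2 hne.2)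
    obtain ⟨f, hf⟩ := exists_polynomial_of_mem_polyFun F.2 p (q - p)
    obtain ⟨g, hg⟩ := exists_polynomial_of_mem_polyFun G.2 p (q - p)
    have hfg : f * g = 0 := Polynomial.funext fun t => by
      simpa [hf, hg] using congrFun (congrArg Subtype.val h) (p + t • (q - p))
    rcases mul_eq_zero.1 hfg with rfl | rfl
    · exact hp (by simpa using hf 0)
    · exact hq (by simpa using hg 1)

lemma isDomain_of_le_polyFun {S : Subalgebra ℂ (W → ℂ)} (h : S ≤ polyFun W) : IsDomain S := by
  have : NoZeroDivisors S :=
    (Subalgebra.inclusion_injective h).noZeroDivisors _ (map_zero _) (map_mul _)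
  exact NoZeroDivisors.to_isDomain S

/-- A map is polynomial if composing it with linear forms gives polynomial functions. -/
def IsPolyMap (Φ : W → W') : Prop := ∀ φ : Module.Dual ℂ W', (fun w => φ (Φ w)) ∈ polyFun W

lemma isPolyMap_const (c : W') : IsPolyMap fun _ : W => c :=
  fun φ => (polyFun W).algebraMap_mem (φ c)

lemma isPolyMap_linear (f : W →ₗ[ℂ] W') : IsPolyMap f :=
  fun φ => dual_mem_polyFun (φ ∘ₗ f)

namespace IsPolyMap

variable {Φ Ψ : W → W'}

lemma add (hΦ : IsPolyMap Φ) (hΨ : IsPolyMap Ψ) : IsPolyMap fun w => Φ w + Ψ w := fun φ => by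
  simpa only [map_add] using! add_mem (hΦ φ) (hΨ φ)

lemma sum {ι : Type*} {I : Finset ι} {Φ : ι → W → W'} (hΦ : ∀ i, IsPolyMap (Φ i)) :
    IsPolyMap fun w => ∑ i ∈ I, Φ i w := fun φ => by
  simpa only [map_sum, ← Finset.sum_fn] using sum_mem fun i _ => hΦ i φ

lemma linear_comp (hΦ : IsPolyMap Φ) (f : W' →ₗ[ℂ] W'') : IsPolyMap fun w => f (Φ w) :=
  fun φ => hΦ (φ ∘ₗ f)

lemma bilinear [FiniteDimensional ℂ W'] {X : Type*} [AddCommGroup X] [Module ℂ X] {Ψ : W → W''}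
    (hΦ : IsPolyMap Φ) (hΨ : IsPolyMap Ψ) (B : W' →ₗ[ℂ] W'' →ₗ[ℂ] X) :
    IsPolyMap fun w => B (Φ w) (Ψ w) := fun φ => by
  let b := Module.finBasis ℂ W'
  have h : (fun w => φ (B (Φ w) (Ψ w))) =
      ∑ i, (fun w => b.coord i (Φ w)) * fun w => (φ ∘ₗ B (b i)) (Ψ w) := by
    ext w
    conv_lhs => rw [← b.sum_repr (Φ w)]
    simp [-Module.Basis.sum_repr]
  exact h ▸ sum_mem fun i _ => mul_mem (hΦ _) (hΨ _)

lemma comp_mem_polyFun (hΦ : IsPolyMap Φ) {F : W' → ℂ} (hF : F ∈ polyFun W') :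
    (fun w => F (Φ w)) ∈ polyFun W := by
  induction hF using Algebra.adjoin_induction with
  | mem x hx => obtain ⟨φ, rfl⟩ := hx; exact hΦ φ
  | algebraMap c => exact (polyFun W).algebraMap_mem c
  | add x y _ _ hx hy => exact add_mem hx hy
  | mul x y _ _ hx hy => exact mul_mem hx hy

lemma comp {Ψ : W' → W''} (hΨ : IsPolyMap Ψ) (hΦ : IsPolyMap Φ) : IsPolyMap fun w => Ψ (Φ w) :=
  fun φ => hΦ.comp_mem_polyFun (hΨ φ)

end IsPolyMap

end PolyFun

section PullbackRing

variable {W W' P Q : Type*} [AddCommGroup W] [Module ℂ W] [AddCommGroup W'] [Module ℂ W']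

/-- Precomposition of functions with a fixed map, as a homomorphism of algebras. -/
def precomp (g : P → Q) : (Q → ℂ) →ₐ[ℂ] (P → ℂ) where
  toFun f := f ∘ g
  map_one' := rfl
  map_mul' _ _ := rfl
  map_zero' := rfl
  map_add' _ _ := rfl
  commutes' _ := rfl

/-- The ring of pullbacks of polynomial functions along a map into a vector space: the coordinate
ring of the closure of its image. -/
def pullbackRing (Φ : P → W) : Subalgebra ℂ (P → ℂ) :=
  (polyFun W).map (precomp Φ)

lemma dual_mem_pullbackRing (Φ : P → W) (φ : Module.Dual ℂ W) :
    (fun p => φ (Φ p)) ∈ pullbackRing Φ :=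
  ⟨φ, dual_mem_polyFun φ, rfl⟩

lemma pullbackRing_le {Φ : P → W} {S : Subalgebra ℂ (P → ℂ)}
    (h : ∀ φ : Module.Dual ℂ W, (fun p => φ (Φ p)) ∈ S) : pullbackRing Φ ≤ S := by
  rw [pullbackRing, polyFun, AlgHom.map_adjoin, Algebra.adjoin_le_iff]
  rintro _ ⟨_, ⟨φ, rfl⟩, rfl⟩
  exact h φ

lemma dual_comp_mem_of_coord_comp_mem {κ : Type*} [Finite κ] (b : Module.Basis κ ℂ W) {Φ : P → W}
    {S : Submodule ℂ (P → ℂ)} (h : ∀ k, (fun p => b.coord k (Φ p)) ∈ S) (φ : Module.Dual ℂ W) :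
    (fun p => φ (Φ p)) ∈ S := by
  have := Fintype.ofFinite κ
  have hφ : (fun p => φ (Φ p)) = ∑ k, φ (b k) • fun p => b.coord k (Φ p) := by
    ext p
    conv_lhs => rw [← b.sum_repr (Φ p)]
    simp [-Module.Basis.sum_repr, mul_comm]
  exact hφ ▸ sum_mem fun k _ => S.smul_mem _ (h k)

lemma pullbackRing_eq_adjoin_basis {κ : Type*} [Finite κ] (b : Module.Basis κ ℂ W) (Φ : P → W) :
    pullbackRing Φ = Algebra.adjoin ℂ (Set.range fun k p => b.coord k (Φ p)) := by
  refine le_antisymm (pullbackRing_le ?_) (Algebra.adjoin_le ?_)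
  · exact dual_comp_mem_of_coord_comp_mem b (S := (Algebra.adjoin ℂ _).toSubmodule)
      fun k => Algebra.subset_adjoin (Set.mem_range_self k)
  · rintro _ ⟨k, rfl⟩
    exact dual_mem_pullbackRing Φ (b.coord k)

lemma finiteType_pullbackRing [FiniteDimensional ℂ W] (Φ : P → W) :
    Algebra.FiniteType ℂ (pullbackRing Φ) := by
  rw [← Subalgebra.fg_iff_finiteType, pullbackRing_eq_adjoin_basis (Module.finBasis ℂ W)]
  exact Subalgebra.fg_def.2 ⟨_, Set.finite_range _, rfl⟩

lemma pullbackRing_comp_injective (Φ : P → W) {j : W →ₗ[ℂ] W'} (hj : Function.Injective j) :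
    pullbackRing (fun p => j (Φ p)) = pullbackRing Φ := by
  obtain ⟨g, hg⟩ := LinearMap.exists_leftInverse_of_injective j (LinearMap.ker_eq_bot.2 hj)
  refine le_antisymm (pullbackRing_le fun φ => dual_mem_pullbackRing Φ (φ ∘ₗ j))
    (pullbackRing_le fun φ => ?_)
  convert dual_mem_pullbackRing (fun p => j (Φ p)) (φ ∘ₗ g) using 2 with p
  exact congrArg φ (LinearMap.congr_fun hg (Φ p)).symm

lemma IsPolyMap.pullbackRing_comp_le {Ψ : W → W'} (hΨ : IsPolyMap Ψ) (Φ : P → W) :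
    pullbackRing (fun p => Ψ (Φ p)) ≤ pullbackRing Φ :=
  pullbackRing_le fun φ => ⟨_, hΨ φ, rfl⟩

lemma IsPolyMap.pullbackRing_le_polyFun {Ψ : W → W'} (hΨ : IsPolyMap Ψ) :
    pullbackRing Ψ ≤ polyFun W :=
  pullbackRing_le hΨ

end PullbackRing

section Trdeg

variable {K R F : Type*} [Field K]

lemma toNat_trdeg_mvPolynomial {σ : Type*} [Finite σ] [CommRing R] [IsDomain R] [Algebra K R]
    (h : Algebra.trdeg K R < Cardinal.aleph0) :
    Cardinal.toNat (Algebra.trdeg K (MvPolynomial σ R)) =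
      Nat.card σ + Cardinal.toNat (Algebra.trdeg K R) := by
  have := congrArg Cardinal.toNat (lift_trdeg_add_eq K R (MvPolynomial σ R))
  rw [Cardinal.toNat_lift, MvPolynomial.trdeg_of_isDomain, Cardinal.toNat_add (by simpa using h)
    (by simp)] at this
  simpa [add_comm, Nat.card] using this.symm

lemma trdeg_eq_of_le_of_isAlgebraic [CommRing F] [Algebra K F] {S T : Subalgebra K F} [IsDomain T]
    (hST : S ≤ T) (halg : ∀ t ∈ T, IsAlgebraic S t) : Algebra.trdeg K S = Algebra.trdeg K T := by
  let _ : Algebra S T := (Subalgebra.inclusion hST).toAlgebra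
  have hinj : Function.Injective (algebraMap S T) := Subalgebra.inclusion_injective hST
  have : IsDomain S := hinj.isDomain (algebraMap S T)
  have : IsScalarTower K S T := IsScalarTower.of_algebraMap_eq fun _ => rfl
  have : FaithfulSMul S T := (faithfulSMul_iff_algebraMap_injective S T).2 hinj
  have : Algebra.IsAlgebraic S T := ⟨fun t => by
    obtain ⟨p, hp, hpt⟩ := halg t t.2
    refine ⟨p, hp, Subtype.ext ?_⟩
    rw [ZeroMemClass.coe_zero, ← hpt]
    exact (Polynomial.aeval_algHom_apply ({ T.val with commutes' := fun _ => rfl } : T →ₐ[S] F)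
      t p).symm⟩
  rw [← trdeg_add_eq K S (A := T), trdeg_eq_zero (R := S), add_zero]

end Trdeg

section ImageDim

variable {W W' P Q : Type*} [AddCommGroup W] [Module ℂ W] [AddCommGroup W'] [Module ℂ W']

/-- The dimension of the closure of the image of a map, as the transcendence degree of the ring of
pullbacks. -/
def imageDim (Φ : P → W) : ℕ := Cardinal.toNat (Algebra.trdeg ℂ (pullbackRing Φ))

lemma imageDim_comp_injective (Φ : P → W) {j : W →ₗ[ℂ] W'} (hj : Function.Injective j) :
    imageDim (fun p => j (Φ p)) = imageDim Φ := by
  rw [imageDim, pullbackRing_comp_injective Φ hj, imageDim]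

lemma imageDim_comp_of_dense (Φ : P → W) (g : Q → P)
    (hg : ∀ F ∈ polyFun W, (∀ x, F (Φ (g x)) = 0) → ∀ p, F (Φ p) = 0) :
    imageDim (fun x => Φ (g x)) = imageDim Φ := by
  let θ : pullbackRing Φ →ₐ[ℂ] (Q → ℂ) := (precomp g).comp (pullbackRing Φ).val
  have hinj : Function.Injective θ := (injective_iff_map_eq_zero θ).2 <| by
    rintro ⟨_, F, hF, rfl⟩ h0
    ext p
    exact hg F hF (congrFun h0) p
  have hrange : θ.range = pullbackRing (fun x => Φ (g x)) := by
    rw [AlgHom.range_comp, Subalgebra.range_val, pullbackRing, pullbackRing, Subalgebra.map_map]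
    rfl
  have e : pullbackRing Φ ≃ₐ[ℂ] pullbackRing (fun x => Φ (g x)) :=
    (AlgEquiv.ofInjective θ hinj).trans (Subalgebra.equivOfEq _ _ hrange)
  simpa [imageDim] using congrArg Cardinal.toNat e.lift_trdeg_eq.symm

lemma imageDim_comp_surjective (Φ : P → W) {g : Q → P} (hg : Function.Surjective g) :
    imageDim (fun x => Φ (g x)) = imageDim Φ :=
  imageDim_comp_of_dense Φ g fun _ _ h => hg.forall.2 h

lemma imageDim_eq_of_range_eq {Φ : P → W} {Ψ : Q → W} (h : Set.range Φ = Set.range Ψ) :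
    imageDim Φ = imageDim Ψ := by
  choose g hg using fun p => h ▸ Set.mem_range_self (f := Φ) p
  choose g' hg' using fun q => h.symm ▸ Set.mem_range_self (f := Ψ) q
  rw [← imageDim_comp_of_dense Ψ g fun F _ h0 q => ?_]
  · exact congrArg imageDim (funext hg).symm
  · rw [← hg' q, ← hg]
    exact h0 _

/-- Polynomials in the coordinates of `U` whose coefficients are pullbacks along `Φ`, as functions
on `U × P`. -/
def evalProd {U κ : Type*} [AddCommGroup U] [Module ℂ U] (b : Module.Basis κ ℂ U) (Φ : P → W) :
    MvPolynomial κ (pullbackRing Φ) →ₐ[ℂ] (U × P → ℂ) :=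
  MvPolynomial.aevalTower ((precomp Prod.snd).comp (pullbackRing Φ).val) fun k q => b.coord k q.1

section EvalProd

variable {U κ : Type*} [AddCommGroup U] [Module ℂ U] (b : Module.Basis κ ℂ U) (Φ : P → W)

lemma evalProd_C (f : pullbackRing Φ) : evalProd b Φ (MvPolynomial.C f) = fun q => f.1 q.2 :=
  MvPolynomial.aevalTower_C ..

lemma evalProd_X (k : κ) : evalProd b Φ (MvPolynomial.X k) = fun q => b.coord k q.1 :=
  MvPolynomial.aevalTower_X ..

lemma evalProd_apply (h : MvPolynomial κ (pullbackRing Φ)) (q : U × P) :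
    evalProd b Φ h q = MvPolynomial.eval₂ ((Pi.evalRingHom _ q.2).comp (pullbackRing Φ).subtype)
      (fun k => b.coord k q.1) h := by
  induction h using MvPolynomial.induction_on with
  | C f => rw [evalProd_C, MvPolynomial.eval₂_C]; rfl
  | add f g hf hg => rw [map_add, Pi.add_apply, hf, hg, MvPolynomial.eval₂_add]
  | mul_X f k hf =>
    rw [map_mul, Pi.mul_apply, hf, evalProd_X, MvPolynomial.eval₂_mul, MvPolynomial.eval₂_X]

lemma evalProd_injective [Finite κ] : Function.Injective (evalProd b Φ) := by
  rw [injective_iff_map_eq_zero]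
  intro h h0
  ext m p
  have hmap : MvPolynomial.map ((Pi.evalRingHom _ p).comp (pullbackRing Φ).subtype) h = 0 := by
    refine MvPolynomial.funext fun x => ?_
    have hx : (fun k => b.coord k (b.equivFun.symm x)) = x :=
      funext fun k => congrFun (b.equivFun.apply_symm_apply x) k
    rw [map_zero, MvPolynomial.eval_map, ← hx, ← evalProd_apply b Φ h (b.equivFun.symm x, p), h0,
      Pi.zero_apply]
  have hm := congrArg (MvPolynomial.coeff m) hmap
  rwa [MvPolynomial.coeff_map] at hm

lemma range_evalProd [Finite κ] :
    (evalProd b Φ).range = pullbackRing fun q : U × P => (q.1, Φ q.2) := by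
  apply le_antisymm
  · rintro _ ⟨h, rfl⟩
    induction h using MvPolynomial.induction_on with
    | C f =>
      obtain ⟨_, F, hF, rfl⟩ := f
      exact ⟨_, (isPolyMap_linear (LinearMap.snd ℂ U W)).comp_mem_polyFun hF,
        (evalProd_C b Φ ⟨_, F, hF, rfl⟩).symm⟩
    | add f g hf hg => exact map_add (evalProd b Φ) f g ▸ add_mem hf hg
    | mul_X f k hf =>
      rw [AlgHom.toRingHom_eq_coe, RingHom.coe_coe] at hf ⊢
      exact map_mul (evalProd b Φ) f _ ▸ mul_mem hf
        (evalProd_X b Φ k ▸ dual_mem_pullbackRing _ (b.coord k ∘ₗ LinearMap.fst ℂ U W))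
  · refine pullbackRing_le fun φ => ?_
    have := Fintype.ofFinite κ
    refine ⟨MvPolynomial.C ⟨_, dual_mem_pullbackRing Φ (φ ∘ₗ LinearMap.inr ℂ U W)⟩ +
      ∑ k, φ (b k, 0) • MvPolynomial.X k, ?_⟩
    ext q
    have hq : q.1 = ∑ k, b.coord k q.1 • b k := (b.sum_repr q.1).symm
    have hφ : φ (q.1, 0) = ∑ k, φ (b k, 0) * b.coord k q.1 := by
      conv_lhs => rw [← LinearMap.inl_apply (R := ℂ) (M₂ := W), hq]
      simp only [map_sum, map_smul, smul_eq_mul, mul_comm, LinearMap.inl_apply]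
    have hadd : φ (q.1, Φ q.2) = φ (0, Φ q.2) + φ (q.1, 0) := by
      rw [← map_add]; simp
    rw [hadd, hφ, AlgHom.toRingHom_eq_coe, RingHom.coe_coe, map_add, map_sum, evalProd_C]
    simp [evalProd_X]

end EvalProd

lemma imageDim_prodMk {U : Type*} [AddCommGroup U] [Module ℂ U] [FiniteDimensional ℂ U]
    [FiniteDimensional ℂ W] (Φ : P → W) [IsDomain (pullbackRing Φ)] :
    imageDim (fun q : U × P => (q.1, Φ q.2)) = Module.finrank ℂ U + imageDim Φ := by
  let b := Module.finBasis ℂ U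
  let e : MvPolynomial _ (pullbackRing Φ) ≃ₐ[ℂ] pullbackRing fun q : U × P => (q.1, Φ q.2) :=
    (AlgEquiv.ofInjective _ (evalProd_injective b Φ)).trans
      (Subalgebra.equivOfEq _ _ (range_evalProd b Φ))
  have := finiteType_pullbackRing Φ
  have hlt : Algebra.trdeg ℂ (pullbackRing Φ) < Cardinal.aleph0 := trdeg_lt_aleph0_of_finiteType
  have htr := congrArg Cardinal.toNat
    (AlgEquiv.lift_trdeg_eq (A := MvPolynomial _ (pullbackRing Φ)) e)
  rw [Cardinal.toNat_lift, Cardinal.toNat_lift, toNat_trdeg_mvPolynomial hlt, Nat.card_fin] at htr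
  exact htr.symm

end ImageDim

section ZariskiClosure

variable {W W' : Type*} [AddCommGroup W] [Module ℂ W] [AddCommGroup W'] [Module ℂ W']

/-- The homogeneous polynomial functions of degree `d`, as a subspace of all functions. -/
def homogeneousForms (W : Type*) [AddCommGroup W] [Module ℂ W] (d : ℕ) : Submodule ℂ (W → ℂ) where
  carrier := {f | IsHomogeneousForm d f}
  add_mem' {f g} hf hg := ⟨add_mem hf.1 hg.1, fun c v => by simp [hf.2, hg.2, mul_add]⟩
  zero_mem' := ⟨zero_mem _, fun c v => by simp⟩
  smul_mem' a f hf := ⟨Subalgebra.smul_mem _ hf.1 a, fun c v => by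
    rw [Pi.smul_apply, Pi.smul_apply, hf.2, smul_eq_mul, smul_eq_mul, mul_left_comm]⟩

lemma polyFun_le_iSup_homogeneousForms :
    Subalgebra.toSubmodule (polyFun W) ≤ ⨆ d, homogeneousForms W d := by
  rw [polyFun, Algebra.adjoin_eq_span, Submodule.span_le]
  intro f hf
  suffices ∃ d, f ∈ homogeneousForms W d by
    obtain ⟨d, hd⟩ := this
    exact Submodule.mem_iSup_of_mem d hd
  induction hf using Submonoid.closure_induction with
  | mem x hx =>
    obtain ⟨φ, rfl⟩ := hx
    exact ⟨1, dual_mem_polyFun φ, fun c v => by simp⟩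
  | one => exact ⟨0, one_mem _, fun c v => by simp⟩
  | mul x y _ _ hx hy =>
    obtain ⟨d, hd⟩ := hx
    obtain ⟨e, he⟩ := hy
    exact ⟨d + e, mul_mem hd.1 he.1, fun c v => by
      rw [Pi.mul_apply, Pi.mul_apply, hd.2, he.2, pow_add, mul_mul_mul_comm]⟩

lemma exists_homogeneous_decomposition {F : W → ℂ} (hF : F ∈ polyFun W) :
    ∃ (I : Finset ℕ) (g : ℕ → W → ℂ), (∀ d, IsHomogeneousForm d (g d)) ∧ F = ∑ d ∈ I, g d := by
  obtain ⟨g, hg, hsum⟩ := (Submodule.mem_iSup_iff_exists_finsupp _ _).1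
    (polyFun_le_iSup_homogeneousForms hF)
  exact ⟨g.support, g, hg, hsum.symm⟩

lemma smul_mem_affineCone {X : Set (Projectivization ℂ W)} {v : W} (hv : v ∈ affineCone X) (c : ℂ) :
    c • v ∈ affineCone X := by
  intro hcv
  have hv0 : v ≠ 0 := by rintro rfl; simp at hcv
  have : Projectivization.mk ℂ (c • v) hcv = Projectivization.mk ℂ v hv0 :=
    (Projectivization.mk_eq_mk_iff' ..).2 ⟨c, rfl⟩
  rw [this]
  exact hv hv0

lemma rep_mem_affineCone {X : Set (Projectivization ℂ W)} {p : Projectivization ℂ W} (hp : p ∈ X) :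
    p.rep ∈ affineCone X := fun h => by rwa [Projectivization.mk_rep]

lemma homogeneous_component_eq_zero {I : Finset ℕ} {g : ℕ → W → ℂ}
    (hg : ∀ d, IsHomogeneousForm d (g d)) {v : W}
    (h : ∀ c : ℂ, ∑ d ∈ I, g d (c • v) = 0) {d : ℕ} (hd : d ∈ I) : g d v = 0 := by
  have h0 : ∑ e ∈ I, Polynomial.monomial e (g e v) = 0 := Polynomial.funext fun t => by
    rw [Polynomial.eval_finsetSum, Polynomial.eval_zero, ← h t]
    exact Finset.sum_congr rfl fun e _ => by rw [Polynomial.eval_monomial, (hg e).2, mul_comm]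
  have := congrArg (fun q => Polynomial.coeff q d) h0
  simpa [Polynomial.finsetSum_coeff, Polynomial.coeff_monomial, hd] using this

lemma subset_zariskiClosure (X : Set (Projectivization ℂ W)) : X ⊆ zariskiClosure X :=
  fun p hp _ _ _ h => h p hp

lemma eq_zero_on_affineCone_zariskiClosure {X : Set (Projectivization ℂ W)} {F : W → ℂ}
    (hF : F ∈ polyFun W) (h : ∀ v ∈ affineCone X, F v = 0) :
    ∀ v ∈ affineCone (zariskiClosure X), F v = 0 := by
  intro v hv
  by_cases hv0 : v = 0
  · exact h v fun h => absurd hv0 h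
  obtain ⟨I, g, hg, rfl⟩ := exists_homogeneous_decomposition hF
  rw [Finset.sum_apply]
  refine Finset.sum_eq_zero fun d hd => ?_
  have h1 : g d (Projectivization.mk ℂ v hv0).rep = 0 := by
    refine hv hv0 d (g d) (hg d) fun q hq => ?_
    refine homogeneous_component_eq_zero hg (fun c => ?_) hd
    simpa using h _ (smul_mem_affineCone (rep_mem_affineCone hq) c)
  obtain ⟨a, ha⟩ := Projectivization.exists_smul_eq_mk_rep ℂ v hv0
  rw [← ha, Units.smul_def, (hg d).2] at h1
  exact (mul_eq_zero.1 h1).resolve_left (pow_ne_zero _ a.ne_zero)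

lemma projDim_eq_imageDim (X : Set (Projectivization ℂ W)) :
    projDim X = (imageDim (Subtype.val : affineCone X → W) : ℤ) - 1 := rfl

lemma projDim_zariskiClosure (X : Set (Projectivization ℂ W)) :
    projDim (zariskiClosure X) = projDim X := by
  rw [projDim_eq_imageDim, projDim_eq_imageDim]
  have hle : affineCone X ⊆ affineCone (zariskiClosure X) := fun v hv h0 =>
    subset_zariskiClosure X (hv h0)
  rw [← imageDim_comp_of_dense (Subtype.val : affineCone (zariskiClosure X) → W)
    (Set.inclusion hle) fun F hF h v =>
      eq_zero_on_affineCone_zariskiClosure hF (fun v hv => h ⟨v, hv⟩) v v.2]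

lemma projDim_eq_imageDim_of_range_eq {P : Type*} {X : Set (Projectivization ℂ W)} {j : W →ₗ[ℂ] W'}
    (hj : Function.Injective j) {Ω : P → W'} (h : Set.range Ω = j '' affineCone X) :
    projDim X = (imageDim Ω : ℤ) - 1 := by
  have hrange : Set.range Ω = Set.range fun v : affineCone X => j v := by
    rw [h, Set.image_eq_range]
  rw [projDim_eq_imageDim, imageDim_eq_of_range_eq hrange, imageDim_comp_injective _ hj]

end ZariskiClosure

section ExteriorAlgebra

variable {R M N : Type*} [CommRing R] [AddCommGroup M] [Module R M] [AddCommGroup N] [Module R N]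

lemma ι_mul_ι_swap (v w : M) : ι R v * ι R w = -(ι R w * ι R v) :=
  eq_neg_of_add_eq_zero_left (ι_add_mul_swap v w)

lemma mul_ιMulti_congr (E : Submodule R M) {m : ℕ} {f f' : Fin m → M} (h : ∀ l, f l - f' l ∈ E)
    {ω : ExteriorAlgebra R M} (hω : ∀ v ∈ E, ω * ι R v = 0) :
    ω * ιMulti R m f = ω * ιMulti R m f' := by
  induction m generalizing ω with
  | zero => simp only [ιMulti_zero_apply]
  | succ m ih =>
    have h0 : ω * ι R (f 0) = ω * ι R (f' 0) := by
      rw [← sub_eq_zero, ← mul_sub, ← map_sub]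
      exact hω _ (h 0)
    rw [ιMulti_succ_apply, ιMulti_succ_apply, ← mul_assoc, ← mul_assoc, h0]
    refine ih (fun l => h l.succ) fun v hv => ?_
    rw [mul_assoc, ι_mul_ι_swap, mul_neg, ← mul_assoc, hω v hv, zero_mul, neg_zero]

lemma ι_mul_ιMulti_of_mem_span {r : ℕ} {e : Fin r → M} {v : M}
    (hv : v ∈ Submodule.span R (Set.range e)) : ι R v * ιMulti R r e = 0 :=
  (Submodule.span_le (p := ((LinearMap.mulRight R (ιMulti R r e)).comp (ι R)).ker)).2
    (Set.range_subset_iff.2 (ι_mul_prod_list e)) hv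

lemma ιMulti_mul_ι {r : ℕ} (e : Fin r → M) (v : M) :
    ιMulti R r e * ι R v = (-1 : R) ^ r • (ι R v * ιMulti R r e) := by
  induction r with
  | zero => simp
  | succ r ih =>
    rw [ιMulti_succ_apply, mul_assoc, ih, mul_smul_comm, ← mul_assoc, ← mul_assoc,
      ι_mul_ι_swap (e 0) v, neg_mul, pow_succ, mul_neg_one, neg_smul, smul_neg]

lemma ιMulti_mul_ι_of_mem_span {r : ℕ} {e : Fin r → M} {v : M}
    (hv : v ∈ Submodule.span R (Set.range e)) : ιMulti R r e * ι R v = 0 := by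
  rw [ιMulti_mul_ι, ι_mul_ιMulti_of_mem_span hv, smul_zero]

lemma exists_ιMulti_eq_smul {k : ℕ} {e e' : Fin k → M}
    (h : ∀ i, e' i ∈ Submodule.span R (Set.range e)) :
    ∃ c : R, ιMulti R k e' = c • ιMulti R k e := by
  choose a ha using fun i => (Submodule.mem_span_range_iff_exists_fun R).1 (h i)
  let b := Pi.basisFun R (Fin k)
  let g := (ιMulti R k).compLinearMap (Fintype.linearCombination R e)
  have hg : g = (LinearMap.toSpanSingleton R _ (g b)).compAlternatingMap b.det := by
    refine Module.Basis.ext_alternating b fun i hi => ?_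
    let σ : Equiv.Perm (Fin k) := Equiv.ofBijective i (Finite.injective_iff_bijective.1 hi)
    change g (b ∘ σ) = (LinearMap.toSpanSingleton R _ (g b)).compAlternatingMap b.det (b ∘ σ)
    rw [AlternatingMap.map_perm, AlternatingMap.map_perm, LinearMap.compAlternatingMap_apply,
      Module.Basis.det_self, LinearMap.toSpanSingleton_apply, one_smul]
  refine ⟨b.det a, ?_⟩
  simpa [g, b, Fintype.linearCombination_apply, ha] using DFunLike.congr_fun hg a

/-- Contraction of the exterior algebra with a linear form. -/
def contract (d : Module.Dual R M) : ExteriorAlgebra R M →ₗ[R] ExteriorAlgebra R M :=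
  CliffordAlgebra.contractLeft (Q := (0 : QuadraticForm R M)) d

lemma contract_ι_mul (d : Module.Dual R M) (v : M) (x : ExteriorAlgebra R M) :
    contract d (ι R v * x) = d v • x - ι R v * contract d x :=
  CliffordAlgebra.contractLeft_ι_mul d v x

lemma contract_one (d : Module.Dual R M) : contract d (1 : ExteriorAlgebra R M) = 0 :=
  CliffordAlgebra.contractLeft_one (Q := (0 : QuadraticForm R M)) d

lemma contract_ιMulti_mul {d : Module.Dual R M} {r : ℕ} {e : Fin r → M} (h : ∀ i, d (e i) = 0)
    (x : ExteriorAlgebra R M) :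
    contract d (ιMulti R r e * x) = (-1 : R) ^ r • (ιMulti R r e * contract d x) := by
  induction r with
  | zero => simp
  | succ r ih =>
    rw [ιMulti_succ_apply, mul_assoc, contract_ι_mul, h 0, zero_smul, zero_sub,
      ih (e := Matrix.vecTail e) fun i => h i.succ, mul_smul_comm, mul_assoc, pow_succ,
      mul_neg_one, neg_smul]

lemma contract_ιMulti_eq_zero {d : Module.Dual R M} {r : ℕ} {e : Fin r → M}
    (h : ∀ i, d (e i) = 0) : contract d (ιMulti R r e) = 0 := by
  simpa [contract_one] using contract_ιMulti_mul h 1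

lemma contract_map_eq_zero {d : Module.Dual R M} {f : N →ₗ[R] M} (h : ∀ u, d (f u) = 0)
    (ω : ExteriorAlgebra R N) : contract d (map f ω) = 0 := by
  induction ω using CliffordAlgebra.left_induction with
  | algebraMap a => rw [AlgHom.commutes, Algebra.algebraMap_eq_smul_one, map_smul, contract_one,
      smul_zero]
  | add x y hx hy => rw [map_add, map_add, hx, hy, add_zero]
  | ι_mul x u hx =>
    change contract d (map f (ι R u * x)) = 0
    rw [map_mul, map_apply_ι, contract_ι_mul, h, hx, zero_smul, mul_zero, sub_zero]

/-- Iterated contraction with a family of linear forms. -/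
def contractFrame : (r : ℕ) → (Fin r → Module.Dual R M) →
    ExteriorAlgebra R M →ₗ[R] ExteriorAlgebra R M
  | 0, _ => LinearMap.id
  | r + 1, d => contractFrame r (fun i => d i.succ) ∘ₗ contract (d 0)

lemma contractFrame_ιMulti_mul {r : ℕ} {d : Fin r → Module.Dual R M} {e : Fin r → M}
    (h : ∀ i j, d i (e j) = if i = j then 1 else 0) {x : ExteriorAlgebra R M}
    (hx : ∀ i, contract (d i) x = 0) : contractFrame r d (ιMulti R r e * x) = x := by
  induction r with
  | zero => simp [contractFrame]
  | succ r ih =>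
    have htail : ∀ i, d 0 (Matrix.vecTail e i) = 0 := fun i => by
      simpa [Matrix.vecTail, (Fin.succ_ne_zero i).symm] using h 0 i.succ
    rw [contractFrame, LinearMap.comp_apply, ιMulti_succ_apply, mul_assoc, contract_ι_mul, h 0 0,
      if_pos rfl, one_smul, contract_ιMulti_mul htail, hx 0, mul_zero, smul_zero, mul_zero,
      sub_zero]
    exact ih (fun i j => by simpa [Matrix.vecTail] using h i.succ j.succ) fun i => hx i.succ

end ExteriorAlgebra

section ExteriorAlgebraField

variable {K V : Type*} [Field K] [AddCommGroup V] [Module K V]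

lemma linearIndependent_of_ιMulti_ne_zero {k : ℕ} {e : Fin k → V} (h : ιMulti K k e ≠ 0) :
    LinearIndependent K e :=
  not_imp_comm.1 (AlternatingMap.map_linearDependent _ _) h

lemma exists_dual_eq_one {E : Submodule K V} {v : V} (hv : v ∉ E) :
    ∃ d : Module.Dual K V, d v = 1 ∧ ∀ u ∈ E, d u = 0 := by
  obtain ⟨d, hd, hker⟩ := Submodule.exists_le_ker_of_notMem hv
  exact ⟨(d v)⁻¹ • d, by simp [hd], fun u hu => by simp [LinearMap.mem_ker.1 (hker hu)]⟩

lemma ιMulti_ne_zero {k : ℕ} {e : Fin k → V} (he : LinearIndependent K e) : ιMulti K k e ≠ 0 := by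
  induction k with
  | zero => simp
  | succ k ih =>
    obtain ⟨htail, h0⟩ := linearIndependent_finSucc.1 he
    obtain ⟨d, hd, hde⟩ := exists_dual_eq_one h0
    have hcontract := contract_ι_mul d (e 0) (ιMulti K k (Fin.tail e))
    rw [contract_ιMulti_eq_zero fun i => hde _ (Submodule.subset_span ⟨i, rfl⟩), hd, one_smul,
      mul_zero, sub_zero] at hcontract
    intro h
    rw [ιMulti_succ_apply] at h
    refine ih htail (hcontract.symm.trans ?_)
    rw [← map_zero (contract d), ← h]
    rfl

lemma exists_ιMulti_succ_eq_ι_mul (d : Module.Dual K V) {m : ℕ} {f : Fin (m + 1) → V}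
    (hf : ∃ l, d (f l) ≠ 0) : ∃ (c : K) (v : V) (g : Fin m → V), (∀ i, d (g i) = 0) ∧
      ιMulti K (m + 1) f = c • (ι K v * ιMulti K m g) := by
  obtain ⟨l, hl⟩ := hf
  let f₀ := f ∘ Equiv.swap 0 l
  have hf₀ : d (f₀ 0) ≠ 0 := by simpa [f₀] using hl
  refine ⟨((Equiv.swap 0 l).sign : ℤ), f₀ 0,
    fun i => f₀ i.succ - (d (f₀ i.succ) / d (f₀ 0)) • f₀ 0, fun i => by simp [hf₀], ?_⟩
  have hswap : ιMulti K (m + 1) f = (Equiv.swap 0 l).sign • ιMulti K (m + 1) f₀ := by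
    rw [AlternatingMap.map_perm, smul_smul, Int.units_mul_self, one_smul]
  rw [hswap, Units.smul_def, Int.cast_smul_eq_zsmul, ιMulti_succ_apply]
  congr 1
  refine mul_ιMulti_congr (Submodule.span K {f₀ 0}) (fun i => ?_) fun v hv => ?_
  · simpa [Matrix.vecTail] using
      Submodule.smul_mem _ _ (Submodule.mem_span_singleton_self (f₀ 0))
  · obtain ⟨a, rfl⟩ := Submodule.mem_span_singleton.1 hv
    rw [map_smul, mul_smul_comm, ι_sq_zero, smul_zero]

lemma exists_contract_ιMulti_eq (d : Module.Dual K V) {m : ℕ} (f : Fin (m + 1) → V) :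
    ∃ (c : K) (g : Fin m → V), contract d (ιMulti K (m + 1) f) = c • ιMulti K m g := by
  by_cases hf : ∃ l, d (f l) ≠ 0
  · obtain ⟨c, v, g, hg, h⟩ := exists_ιMulti_succ_eq_ι_mul d hf
    exact ⟨c * d v, g, by
      rw [h, map_smul, contract_ι_mul, contract_ιMulti_eq_zero hg, mul_zero, sub_zero, smul_smul]⟩
  · push Not at hf
    exact ⟨0, 0, by rw [contract_ιMulti_eq_zero hf, zero_smul]⟩

end ExteriorAlgebraField

section Frames

variable {K V : Type*} [Field K] [AddCommGroup V] [Module K V]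

lemma exists_linearIndependent_append {r : ℕ} {e : Fin r → V} (he : LinearIndependent K e)
    {E : Submodule K V} {m : ℕ} (h : r + m ≤ Module.finrank K E) :
    ∃ f : Fin m → V, (∀ i, f i ∈ E) ∧ LinearIndependent K (Fin.append e f) := by
  induction m with
  | zero => exact ⟨Fin.elim0, fun i => i.elim0, by rwa [Fin.append_elim0]⟩
  | succ m ih =>
    obtain ⟨f, hfE, hf⟩ := ih (by lia)
    have := FiniteDimensional.span_of_finite K (Set.finite_range (Fin.append e f))
    have hE : ¬ E ≤ Submodule.span K (Set.range (Fin.append e f)) := fun hle => by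
      have := Submodule.finrank_mono hle
      rw [finrank_span_eq_card hf, Fintype.card_fin] at this
      lia
    obtain ⟨v, hvE, hv⟩ := SetLike.not_le_iff_exists.1 hE
    refine ⟨Fin.snoc f v, Fin.lastCases (by simpa using hvE) (by simpa using hfE), ?_⟩
    rw [Fin.append_snoc]
    exact hf.finSnoc hv

lemma exists_linearEquiv_prod_of_linearIndependent [FiniteDimensional K V] {r : ℕ} {e : Fin r → V}
    (he : LinearIndependent K e) (U : Type*) [AddCommGroup U] [Module K U] [FiniteDimensional K U]
    (hU : r + Module.finrank K U = Module.finrank K V) :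
    ∃ φ : V ≃ₗ[K] (Fin r → K) × U, ∀ i, φ (e i) = (Pi.single i 1, 0) := by
  obtain ⟨T, hT⟩ := exists_isCompl (Submodule.span K (Set.range e))
  have hTU : Module.finrank K T = Module.finrank K U := by
    have := Submodule.finrank_add_eq_of_isCompl hT
    rw [finrank_span_eq_card he, Fintype.card_fin] at this
    lia
  let b := Module.Basis.span he
  refine ⟨(Submodule.prodEquivOfIsCompl _ _ hT).symm ≪≫ₗ
    b.equivFun.prodCongr (LinearEquiv.ofFinrankEq _ _ hTU), fun i => ?_⟩
  have hb : e i = (b i : V) := congrArg Subtype.val (Module.Basis.span_apply he i).symm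
  rw [LinearEquiv.trans_apply, hb, Submodule.prodEquivOfIsCompl_symm_apply_left]
  simp [Finsupp.single_eq_pi_single]

end Frames

section Cramer

open scoped Matrix

variable {A B κ : Type*} [CommRing A] [CommRing B] [Algebra B A] [Fintype κ] [DecidableEq κ]

lemma isAlgebraic_of_mulVec_eq {N : Matrix κ κ B} (hN : N.det ≠ 0) {y : κ → A} {c : κ → B}
    (h : N.map (algebraMap B A) *ᵥ y = algebraMap B A ∘ c) (i : κ) : IsAlgebraic B (y i) := by
  have hcramer : algebraMap B A N.det * y i = algebraMap B A ((N.adjugate *ᵥ c) i) := by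
    have hdet : (N.map (algebraMap B A)).det = algebraMap B A N.det :=
      (RingHom.map_det (algebraMap B A) N).symm
    have hadj : (N.map (algebraMap B A)).adjugate = N.adjugate.map (algebraMap B A) :=
      (RingHom.map_adjugate (algebraMap B A) N).symm
    have := congrFun (congrArg ((N.map (algebraMap B A)).adjugate *ᵥ ·) h) i
    rw [Matrix.mulVec_mulVec, Matrix.adjugate_mul, Matrix.smul_mulVec, Matrix.one_mulVec, hdet,
      hadj] at this
    rw [RingHom.map_mulVec]
    exact this
  refine ⟨.C N.det * .X - .C ((N.adjugate *ᵥ c) i), fun h0 => hN ?_, ?_⟩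
  · simpa using congrArg (Polynomial.coeff · 1) h0
  · simp [hcramer]

lemma isAlgebraic_pullbackRing_of_linear_system {P U W W' : Type*} [AddCommGroup U] [Module ℂ U]
    [FiniteDimensional ℂ U] [AddCommGroup W] [Module ℂ W] [AddCommGroup W'] [Module ℂ W']
    {Ω : P → W} (L : W →ₗ[ℂ] U →ₗ[ℂ] W') (c : W →ₗ[ℂ] W') {y : P → U}
    (hy : ∀ p, L (Ω p) (y p) = c (Ω p)) {p₀ : P} (hp₀ : Function.Injective (L (Ω p₀)))
    [IsDomain (pullbackRing Ω)] (φ : Module.Dual ℂ U) :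
    IsAlgebraic (pullbackRing Ω) fun p => φ (y p) := by
  obtain ⟨π, hπ⟩ := LinearMap.exists_leftInverse_of_injective _ (LinearMap.ker_eq_bot.2 hp₀)
  let b := Module.finBasis ℂ U
  let N : Matrix _ _ (pullbackRing Ω) := .of fun l k =>
    ⟨fun p => b.coord l (π (L (Ω p) (b k))),
      dual_mem_pullbackRing Ω (b.coord l ∘ₗ π ∘ₗ L.flip (b k))⟩
  let ev : pullbackRing Ω →+* ℂ := (Pi.evalRingHom _ p₀).comp (pullbackRing Ω).val.toRingHom
  have hN : N.det ≠ 0 := fun h => by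
    have hone : N.map ev = 1 := Matrix.ext fun l k => by
      change b.coord l ((π ∘ₗ L (Ω p₀)) (b k)) = _
      rw [hπ, LinearMap.id_apply, Module.Basis.coord_apply, b.repr_self, Matrix.one_apply,
        Finsupp.single_apply]
      simp only [eq_comm]
    have := congrArg ev h
    rw [RingHom.map_det, RingHom.mapMatrix_apply, hone, Matrix.det_one, map_zero] at this
    exact one_ne_zero this
  have hcoord : ∀ k, IsAlgebraic (pullbackRing Ω) fun p => b.coord k (y p) :=
    isAlgebraic_of_mulVec_eq hN (y := fun k p => b.coord k (y p))
      (c := fun l => ⟨fun p => b.coord l (π (c (Ω p))),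
        dual_mem_pullbackRing Ω (b.coord l ∘ₗ π ∘ₗ c)⟩) <| funext fun l => funext fun p => by
      change (∑ k, fun p => b.coord l (π (L (Ω p) (b k))) * b.coord k (y p)) p =
        b.coord l (π (c (Ω p)))
      rw [← hy]
      conv_rhs => rw [← b.sum_repr (y p)]
      simp [-Module.Basis.sum_repr, mul_comm]
  exact dual_comp_mem_of_coord_comp_mem b
    (S := ((Subalgebra.algebraicClosure (pullbackRing Ω) (P → ℂ)).restrictScalars ℂ).toSubmodule)
    hcoord φ

end Cramer

section GraphChart

variable {r : ℕ} {U : Type*} [AddCommGroup U] [Module ℂ U]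

/-- The frame of the graph of the linear map `ℂ^r → U` with columns `a`; these graphs form the
standard affine chart of the Grassmannian of `r`-planes in `ℂ^r × U`. -/
def graphFrame (a : Fin r → U) (j : Fin r) : (Fin r → ℂ) × U := (Pi.single j 1, a j)

/-- The affine chart of the bundle over the Grassmannian of `r`-planes in `ℂ^r × U` whose points are
the multivectors divisible by the `r`-plane: the graph of `q.1` is the plane, `q.2` the cofactor. -/
def graphChart (q : (Fin r → U) × ExteriorAlgebra ℂ U) : ExteriorAlgebra ℂ ((Fin r → ℂ) × U) :=
  ιMulti ℂ r (graphFrame q.1) * map (LinearMap.inr ℂ (Fin r → ℂ) U) q.2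

/-- The contraction along `ℂ^r`, which recovers the cofactor from a point of `graphChart`. -/
def graphContract : ExteriorAlgebra ℂ ((Fin r → ℂ) × U) →ₗ[ℂ] ExteriorAlgebra ℂ U :=
  (map (LinearMap.snd ℂ (Fin r → ℂ) U)).toLinearMap ∘ₗ
    contractFrame r fun i => LinearMap.proj i ∘ₗ LinearMap.fst ℂ (Fin r → ℂ) U

lemma graphContract_graphChart (q : (Fin r → U) × ExteriorAlgebra ℂ U) :
    graphContract (graphChart q) = q.2 := by
  rw [graphContract, graphChart, LinearMap.comp_apply, contractFrame_ιMulti_mul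
    (fun i j => by simp [graphFrame, Pi.single_apply])
    fun i => contract_map_eq_zero (fun _ => by simp) _]
  change map _ (map _ q.2) = _
  rw [← AlgHom.comp_apply, map_comp_map, LinearMap.snd_comp_inr, map_id, AlgHom.id_apply]

lemma ι_inr_mul_graphChart (u : U) (a : Fin r → U) (ω : ExteriorAlgebra ℂ U) :
    ι ℂ (0, u) * graphChart (a, ω) = (-1 : ℂ) ^ r • graphChart (a, ι ℂ u * ω) := by
  rw [graphChart, graphChart, map_mul, map_apply_ι, LinearMap.inr_apply, ← mul_assoc, ← mul_assoc,
    ιMulti_mul_ι, smul_mul_assoc, smul_smul, ← mul_pow, neg_one_mul, neg_neg, one_pow, one_smul]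

lemma ι_graphFrame_mul_graphChart (q : (Fin r → U) × ExteriorAlgebra ℂ U) (j : Fin r) :
    ι ℂ (graphFrame q.1 j) * graphChart q = 0 := by
  rw [graphChart, ← mul_assoc, ι_mul_ιMulti_of_mem_span (Submodule.subset_span ⟨j, rfl⟩), zero_mul]

lemma eq_zero_of_ι_inr_mul_graphChart {ω : ExteriorAlgebra ℂ U} (h : ∀ u, ι ℂ u * ω = 0 → u = 0)
    {a : Fin r → U} {u : U} (hu : ι ℂ (0, u) * graphChart (a, ω) = 0) : u = 0 := by
  rw [ι_inr_mul_graphChart] at hu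
  refine h u ?_
  have := (smul_eq_zero_iff_right (pow_ne_zero r (neg_ne_zero.2 one_ne_zero))).1 hu
  simpa [graphContract_graphChart] using congrArg graphContract this

section Algebraic

variable [FiniteDimensional ℂ U] {P : Type*} {q : P → (Fin r → U) × ExteriorAlgebra ℂ U}
  [IsDomain (pullbackRing fun x => graphChart (q x))]

lemma isAlgebraic_frame_coordinate {p₀ : P} (hp₀ : ∀ u, ι ℂ u * (q p₀).2 = 0 → u = 0)
    (j : Fin r) (φ : Module.Dual ℂ U) :
    IsAlgebraic (pullbackRing fun x => graphChart (q x)) fun x => φ ((q x).1 j) := by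
  let V := (Fin r → ℂ) × U
  let μ : V →ₗ[ℂ] ExteriorAlgebra ℂ V →ₗ[ℂ] ExteriorAlgebra ℂ V := LinearMap.mul ℂ _ ∘ₗ ι ℂ
  refine isAlgebraic_pullbackRing_of_linear_system (y := fun x => (q x).1 j) (p₀ := p₀)
    (μ.flip.compl₂ (LinearMap.inr ℂ (Fin r → ℂ) U)) (-μ (Pi.single j 1, 0)) (fun x => ?_) ?_ φ
  · change ι ℂ (0, (q x).1 j) * _ = -(ι ℂ (Pi.single j 1, 0) * _)
    rw [eq_neg_iff_add_eq_zero, ← add_mul, ← map_add, Prod.mk_add_mk, zero_add, add_zero]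
    exact ι_graphFrame_mul_graphChart (q x) j
  · exact (injective_iff_map_eq_zero _).2 fun u => eq_zero_of_ι_inr_mul_graphChart hp₀

lemma isAlgebraic_of_mem_pullbackRing (h : r = 0 ∨ ∃ p₀, ∀ u, ι ℂ u * (q p₀).2 = 0 → u = 0)
    {t : P → ℂ} (ht : t ∈ pullbackRing q) :
    IsAlgebraic (pullbackRing fun x => graphChart (q x)) t := by
  have hframe (j : Fin r) (φ : Module.Dual ℂ U) :
      IsAlgebraic (pullbackRing fun x => graphChart (q x)) fun x => φ ((q x).1 j) := by
    rcases h with rfl | ⟨p₀, hp₀⟩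
    · exact j.elim0
    · exact isAlgebraic_frame_coordinate hp₀ j φ
  let C := Subalgebra.algebraicClosure (pullbackRing fun x => graphChart (q x)) (P → ℂ)
  refine pullbackRing_le (S := C.restrictScalars ℂ) (fun φ => ?_) ht
  have hφ : (fun x => φ (q x)) =
      ∑ j, (fun x => (φ ∘ₗ LinearMap.inl ℂ _ _ ∘ₗ LinearMap.single ℂ (fun _ => U) j) ((q x).1 j)) +
      fun x => (φ ∘ₗ LinearMap.inr ℂ _ _ ∘ₗ graphContract) (graphChart (q x)) := by
    ext x
    have hq : q x = LinearMap.inl ℂ _ _ (∑ j, LinearMap.single ℂ (fun _ => U) j ((q x).1 j)) +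
        LinearMap.inr ℂ _ _ (q x).2 := by
      simp [Finset.univ_sum_single]
    conv_lhs => rw [hq]
    simp only [map_add, map_sum, Pi.add_apply, Finset.sum_apply, LinearMap.comp_apply,
      graphContract_graphChart]
  rw [hφ]
  exact add_mem (sum_mem fun j _ => hframe j _) (C.algebraMap_mem
    (⟨_, dual_mem_pullbackRing (fun x => graphChart (q x)) (φ ∘ₗ LinearMap.inr ℂ _ _ ∘ₗ
      graphContract)⟩ : pullbackRing fun x => graphChart (q x)))

end Algebraic

lemma isPolyMap_ιMulti {V W : Type*} [AddCommGroup V] [Module ℂ V] [FiniteDimensional ℂ V]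
    [AddCommGroup W] [Module ℂ W] {m : ℕ} {f : Fin m → W → V} (hf : ∀ j, IsPolyMap (f j)) :
    IsPolyMap fun w => ιMulti ℂ m fun j => f j w := by
  induction m with
  | zero => simpa only [ιMulti_zero_apply] using isPolyMap_const 1
  | succ m ih =>
    simp only [ιMulti_succ_apply]
    exact (hf 0).bilinear (ih fun j => hf j.succ) (LinearMap.mul ℂ _ ∘ₗ ι ℂ)

instance finiteDimensional_exteriorAlgebra (V : Type*) [AddCommGroup V] [Module ℂ V]
    [FiniteDimensional ℂ V] : FiniteDimensional ℂ (ExteriorAlgebra ℂ V) :=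
  Module.Basis.finiteDimensional_of_finite (Module.finBasis ℂ V).ExteriorAlgebra

variable [FiniteDimensional ℂ U]

lemma isPolyMap_graphChart :
    IsPolyMap (graphChart : (Fin r → U) × ExteriorAlgebra ℂ U → _) := by
  have hframe (j : Fin r) : IsPolyMap fun q : (Fin r → U) × ExteriorAlgebra ℂ U =>
      graphFrame q.1 j := by
    have h := (isPolyMap_const ((Pi.single j 1, 0) : (Fin r → ℂ) × U)).add (isPolyMap_linear
      (LinearMap.inr ℂ (Fin r → ℂ) U ∘ₗ LinearMap.proj j ∘ₗ
        LinearMap.fst ℂ (Fin r → U) (ExteriorAlgebra ℂ U)))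
    simpa [graphFrame] using h
  exact (isPolyMap_ιMulti hframe).bilinear (isPolyMap_linear
    ((map (LinearMap.inr ℂ (Fin r → ℂ) U)).toLinearMap ∘ₗ LinearMap.snd ℂ _ _)) (LinearMap.mul ℂ _)

variable {P : Type*} [AddCommGroup P] [Module ℂ P]

lemma imageDim_graphChart_comp {q : P → (Fin r → U) × ExteriorAlgebra ℂ U} (hq : IsPolyMap q)
    (h : r = 0 ∨ ∃ p, ∀ u, ι ℂ u * (q p).2 = 0 → u = 0) :
    imageDim (fun x => graphChart (q x)) = imageDim q := by
  have hle := isPolyMap_graphChart.pullbackRing_comp_le q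
  have := isDomain_of_le_polyFun hq.pullbackRing_le_polyFun
  have := isDomain_of_le_polyFun (hle.trans hq.pullbackRing_le_polyFun)
  rw [imageDim, trdeg_eq_of_le_of_isAlgebraic hle fun t => isAlgebraic_of_mem_pullbackRing h,
    imageDim]

lemma imageDim_graphChart_prod {Ψ : P → ExteriorAlgebra ℂ U} (hΨ : IsPolyMap Ψ)
    (h : r = 0 ∨ ∃ p, ∀ u, ι ℂ u * Ψ p = 0 → u = 0) :
    imageDim (fun x : (Fin r → U) × P => graphChart (x.1, Ψ x.2)) =
      r * Module.finrank ℂ U + imageDim Ψ := by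
  have := isDomain_of_le_polyFun hΨ.pullbackRing_le_polyFun
  have hprod : IsPolyMap fun x : (Fin r → U) × P => (x.1, Ψ x.2) := fun φ => by
    have h := ((isPolyMap_linear (LinearMap.inl ℂ _ _ ∘ₗ LinearMap.fst ℂ (Fin r → U) P)).add
      ((hΨ.comp (isPolyMap_linear (LinearMap.snd ℂ (Fin r → U) P))).linear_comp
        (LinearMap.inr ℂ (Fin r → U) (ExteriorAlgebra ℂ U)))) φ
    simpa using h
  rw [imageDim_graphChart_comp hprod (h.imp_right fun ⟨p, hp⟩ => ⟨(0, p), hp⟩), imageDim_prodMk,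
    Module.finrank_pi_fintype, Finset.sum_const, Finset.card_univ, Fintype.card_fin, smul_eq_mul]

end GraphChart

section RestrictedSum

variable {V V' : Type*} [AddCommGroup V] [Module ℂ V] [AddCommGroup V'] [Module ℂ V'] {s r m : ℕ}

/-- The data of a linear combination of `s` decomposable `m`-vectors: its coefficients, and for
every summand the vectors to be wedged. -/
abbrev SecParam (s m : ℕ) (V : Type*) := (Fin s → ℂ) × (Fin s → Fin m → V)

/-- The linear combination `∑ i, cᵢ fᵢ₁ ∧ ⋯ ∧ fᵢₘ`: a point of the affine cone over the `s`-secant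
variety of the Grassmannian. It lives in the exterior algebra so that products can be formed. -/
def wedgeSum (p : SecParam s m V) : ExteriorAlgebra ℂ V :=
  ∑ i, p.1 i • ιMulti ℂ m (p.2 i)

/-- The multiple `e₁ ∧ ⋯ ∧ e_r ∧ ∑ i, cᵢ fᵢ₁ ∧ ⋯ ∧ fᵢₘ`: a point of the affine cone over the
`r`-restricted `s`-secant variety. -/
def restrictedSum (q : (Fin r → V) × SecParam s m V) : ExteriorAlgebra ℂ V :=
  ιMulti ℂ r q.1 * wedgeSum q.2

lemma restrictedSum_eq_sum (q : (Fin r → V) × SecParam s m V) :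
    restrictedSum q = ∑ i, q.2.1 i • (ιMulti ℂ r q.1 * ιMulti ℂ m (q.2.2 i)) := by
  simp only [restrictedSum, wedgeSum, Finset.mul_sum, mul_smul_comm]

lemma smul_wedgeSum (d : ℂ) (p : SecParam s m V) : d • wedgeSum p = wedgeSum (d • p.1, p.2) := by
  simp only [wedgeSum, Finset.smul_sum, smul_smul, Pi.smul_apply, smul_eq_mul]

lemma map_wedgeSum (f : V →ₗ[ℂ] V') (p : SecParam s m V) :
    map f (wedgeSum p) = wedgeSum (p.1, fun i => f ∘ p.2 i) := by
  simp only [wedgeSum, map_sum, map_smul, map_apply_ιMulti]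

lemma map_restrictedSum (f : V →ₗ[ℂ] V') (q : (Fin r → V) × SecParam s m V) :
    map f (restrictedSum q) = restrictedSum (f ∘ q.1, q.2.1, fun i => f ∘ q.2.2 i) := by
  rw [restrictedSum, map_mul, map_apply_ιMulti, map_wedgeSum, restrictedSum]

lemma imageDim_restrictedSum_congr (φ : V ≃ₗ[ℂ] V') :
    imageDim (restrictedSum : (Fin r → V) × SecParam s m V → _) =
      imageDim (restrictedSum : (Fin r → V') × SecParam s m V' → _) := by
  have hinj : Function.Injective (map φ.toLinearMap).toLinearMap :=
    map_injective ⟨φ.symm.toLinearMap, LinearMap.ext φ.symm_apply_apply⟩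
  rw [← imageDim_comp_injective _ hinj]
  refine Eq.trans (congrArg imageDim (funext (map_restrictedSum _))) <|
    imageDim_comp_surjective restrictedSum fun q =>
      ⟨(φ.symm ∘ q.1, q.2.1, fun i => φ.symm ∘ q.2.2 i), ?_⟩
  simp [Function.comp_def]

variable [FiniteDimensional ℂ V]

lemma isPolyMap_wedgeSum : IsPolyMap (wedgeSum : SecParam s m V → _) := by
  have hcoeff (i : Fin s) : IsPolyMap fun p : SecParam s m V => p.1 i :=
    isPolyMap_linear ((LinearMap.proj i).comp (LinearMap.fst ℂ (Fin s → ℂ) (Fin s → Fin m → V)))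
  have hvector (i : Fin s) (j : Fin m) : IsPolyMap fun p : SecParam s m V => p.2 i j :=
    isPolyMap_linear ((LinearMap.proj j).comp ((LinearMap.proj i).comp
      (LinearMap.snd ℂ (Fin s → ℂ) (Fin s → Fin m → V))))
  exact IsPolyMap.sum fun i => (hcoeff i).bilinear (isPolyMap_ιMulti (hvector i))
    (LinearMap.lsmul ℂ (ExteriorAlgebra ℂ V))

lemma isPolyMap_restrictedSum :
    IsPolyMap (restrictedSum : (Fin r → V) × SecParam s m V → _) := by
  have hframe (j : Fin r) : IsPolyMap fun q : (Fin r → V) × SecParam s m V => q.1 j :=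
    isPolyMap_linear ((LinearMap.proj j).comp (LinearMap.fst ℂ (Fin r → V) (SecParam s m V)))
  exact (isPolyMap_ιMulti hframe).bilinear
    (isPolyMap_wedgeSum.comp (isPolyMap_linear (LinearMap.snd ℂ (Fin r → V) (SecParam s m V))))
    (LinearMap.mul ℂ (ExteriorAlgebra ℂ V))

end RestrictedSum

section Density

variable {U : Type*} [AddCommGroup U] [Module ℂ U] {s r m : ℕ}

lemma det_mem_subalgebra {P R A κ : Type*} [CommRing R] [CommRing A] [Algebra R A] [Fintype κ]
    [DecidableEq κ] {S : Subalgebra R (P → A)} {N : P → Matrix κ κ A}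
    (h : ∀ i j, (fun p => N p i j) ∈ S) : (fun p => (N p).det) ∈ S := by
  let N' : Matrix κ κ S := .of fun i j => ⟨_, h i j⟩
  have hdet : (fun p => (N p).det) = (N'.det : P → A) := funext fun p =>
    (RingHom.map_det ((Pi.evalRingHom (fun _ => A) p).comp S.toSubring.subtype) N').symm
  exact hdet ▸ N'.det.2

lemma sub_inr_mem_span_graphFrame (a : Fin r → U) (v : (Fin r → ℂ) × U) :
    v - (0, v.2 - ∑ j, v.1 j • a j) ∈ Submodule.span ℂ (Set.range (graphFrame a)) := by
  refine (Submodule.mem_span_range_iff_exists_fun ℂ).2 ⟨v.1, ?_⟩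
  ext
  · simp [graphFrame, Prod.fst_sum, Pi.single_apply]
  · simp [graphFrame, Prod.snd_sum]

lemma exists_forall_mem_span_graphFrame {e : Fin r → (Fin r → ℂ) × U}
    (he : (Matrix.of fun i => (e i).1).det ≠ 0) :
    ∃ a : Fin r → U, ∀ i, e i ∈ Submodule.span ℂ (Set.range (graphFrame a)) := by
  let G : Matrix (Fin r) (Fin r) ℂ := .of fun i => (e i).1
  let a (j : Fin r) : U := ∑ k, G⁻¹ j k • (e k).2
  have ha (i : Fin r) : ∑ j, (e i).1 j • a j = (e i).2 := calc
    ∑ j, (e i).1 j • a j = ∑ k, (G * G⁻¹) i k • (e k).2 := by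
      simp only [a, Finset.smul_sum, smul_smul, Matrix.mul_apply, Finset.sum_smul]
      exact Finset.sum_comm
    _ = (e i).2 := by simp [Matrix.mul_nonsing_inv G he.isUnit, Matrix.one_apply]
  refine ⟨a, fun i => ?_⟩
  have := sub_inr_mem_span_graphFrame a (e i)
  rwa [ha, sub_self, Prod.mk_zero_zero, sub_zero] at this

lemma graphChart_wedgeSum (a : Fin r → U) (p : SecParam s m U) : graphChart (a, wedgeSum p) =
    restrictedSum (graphFrame a, p.1, fun i => LinearMap.inr ℂ (Fin r → ℂ) U ∘ p.2 i) := by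
  rw [graphChart, map_wedgeSum, restrictedSum]

lemma ιMulti_graphFrame_mul_wedgeSum (a : Fin r → U) (p : SecParam s m ((Fin r → ℂ) × U)) :
    ιMulti ℂ r (graphFrame a) * wedgeSum p =
      graphChart (a, wedgeSum (p.1, fun i l => (p.2 i l).2 - ∑ j, (p.2 i l).1 j • a j)) := by
  rw [graphChart_wedgeSum, restrictedSum_eq_sum, wedgeSum, Finset.mul_sum]
  refine Finset.sum_congr rfl fun i _ => ?_
  rw [mul_smul_comm]
  congr 1
  exact mul_ιMulti_congr _ (fun l => sub_inr_mem_span_graphFrame a (p.2 i l))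
    fun v hv => ιMulti_mul_ι_of_mem_span hv

lemma exists_restrictedSum_eq_graphChart {a : Fin r → U}
    {q : (Fin r → (Fin r → ℂ) × U) × SecParam s m ((Fin r → ℂ) × U)}
    (h : ∀ i, q.1 i ∈ Submodule.span ℂ (Set.range (graphFrame a))) :
    ∃ p : SecParam s m U, restrictedSum q = graphChart (a, wedgeSum p) := by
  obtain ⟨d, hd⟩ := exists_ιMulti_eq_smul h
  refine ⟨_, Eq.trans ?_ (ιMulti_graphFrame_mul_wedgeSum a (d • q.2.1, q.2.2))⟩
  rw [restrictedSum, hd, smul_mul_assoc, ← mul_smul_comm, smul_wedgeSum]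

variable [FiniteDimensional ℂ U]

lemma eq_zero_of_eq_zero_on_graphChart {F : ExteriorAlgebra ℂ ((Fin r → ℂ) × U) → ℂ}
    (hF : F ∈ polyFun _)
    (h : ∀ x : (Fin r → U) × SecParam s m U, F (graphChart (x.1, wedgeSum x.2)) = 0)
    (q : (Fin r → (Fin r → ℂ) × U) × SecParam s m ((Fin r → ℂ) × U)) : F (restrictedSum q) = 0 := by
  let P := (Fin r → (Fin r → ℂ) × U) × SecParam s m ((Fin r → ℂ) × U)
  let Fσ : polyFun P := ⟨fun q => F (restrictedSum q), isPolyMap_restrictedSum.comp_mem_polyFun hF⟩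
  let δ : polyFun P := ⟨fun q => (Matrix.of fun i => (q.1 i).1).det,
    det_mem_subalgebra fun i j => dual_mem_polyFun <| (LinearMap.proj j).comp <|
      (LinearMap.fst ℂ (Fin r → ℂ) U).comp <| (LinearMap.proj i).comp <|
        LinearMap.fst ℂ (Fin r → (Fin r → ℂ) × U) (SecParam s m ((Fin r → ℂ) × U))⟩
  have hδ : δ ≠ 0 := fun h0 => by
    have h1 := congrFun (congrArg Subtype.val h0) (fun i => (Pi.single i 1, 0), 0)
    have hone : (Matrix.of fun i : Fin r => (Pi.single i 1 : Fin r → ℂ)) = 1 := by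
      ext i j
      simp [Matrix.one_apply, Pi.single_apply, eq_comm]
    exact one_ne_zero ((hone ▸ Matrix.det_one (n := Fin r) (R := ℂ)).symm.trans h1)
  have hmul : Fσ * δ = 0 := by
    ext q
    by_cases hq : (Matrix.of fun i => (q.1 i).1).det = 0
    · exact mul_eq_zero_of_right _ hq
    · obtain ⟨a, ha⟩ := exists_forall_mem_span_graphFrame hq
      obtain ⟨p, hp⟩ := exists_restrictedSum_eq_graphChart ha
      exact mul_eq_zero_of_left ((congrArg F hp).trans (h (a, p))) _
  exact congrFun (congrArg Subtype.val ((mul_eq_zero.1 hmul).resolve_right hδ)) q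

lemma imageDim_restrictedSum_prod
    (h : r = 0 ∨ ∃ p : SecParam s m U, ∀ u, ι ℂ u * wedgeSum p = 0 → u = 0) :
    imageDim (restrictedSum : (Fin r → (Fin r → ℂ) × U) × SecParam s m ((Fin r → ℂ) × U) → _) =
      r * Module.finrank ℂ U + imageDim (wedgeSum : SecParam s m U → _) := by
  rw [← imageDim_graphChart_prod isPolyMap_wedgeSum h]
  simp only [graphChart_wedgeSum]
  exact (imageDim_comp_of_dense restrictedSum _ fun F hF h0 =>
    eq_zero_of_eq_zero_on_graphChart hF fun x => by rw [graphChart_wedgeSum, h0]).symm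

end Density

section AdaptedSplitting

variable {V U : Type*} [AddCommGroup V] [Module ℂ V] [AddCommGroup U] [Module ℂ U] {s r m : ℕ}

lemma map_restrictedSum_eq_graphChart {q : (Fin r → V) × SecParam s m V}
    {φ : V →ₗ[ℂ] (Fin r → ℂ) × U} (hφ : ∀ i, φ (q.1 i) = (Pi.single i 1, 0)) :
    map φ (restrictedSum q) =
      graphChart (0, wedgeSum (q.2.1, fun i l => (φ (q.2.2 i l)).2)) := by
  have hframe : φ ∘ q.1 = graphFrame 0 := funext hφ
  rw [map_restrictedSum, restrictedSum, hframe, ιMulti_graphFrame_mul_wedgeSum]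
  simp

lemma eq_zero_of_ι_mul_wedgeSum_eq_zero {q : (Fin r → V) × SecParam s m V}
    (hq : ∀ v, ι ℂ v * restrictedSum q = 0 → v ∈ Submodule.span ℂ (Set.range q.1))
    {φ : V ≃ₗ[ℂ] (Fin r → ℂ) × U} (hφ : ∀ i, φ (q.1 i) = (Pi.single i 1, 0)) {u : U}
    (hu : ι ℂ u * wedgeSum (q.2.1, fun i l => (φ (q.2.2 i l)).2) = 0) : u = 0 := by
  have hinj : Function.Injective (map φ.toLinearMap) :=
    map_injective ⟨φ.symm.toLinearMap, LinearMap.ext φ.symm_apply_apply⟩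
  have hmem : φ.symm (0, u) ∈ Submodule.span ℂ (Set.range q.1) := hq _ <| hinj <| by
    rw [map_mul, map_apply_ι, map_restrictedSum_eq_graphChart (φ := φ.toLinearMap) hφ, map_zero]
    simp only [LinearEquiv.coe_coe, LinearEquiv.apply_symm_apply]
    rw [ι_inr_mul_graphChart, hu, graphChart, map_zero, mul_zero, smul_zero]
  have hle : Submodule.span ℂ (Set.range q.1) ≤ (LinearMap.snd ℂ _ _ ∘ₗ φ.toLinearMap).ker := by
    rw [Submodule.span_le, Set.range_subset_iff]
    exact fun i => by simp [hφ]
  simpa using hle hmem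

lemma imageDim_restrictedSum [FiniteDimensional ℂ V] [FiniteDimensional ℂ U]
    {e : Fin r → V} (he : LinearIndependent ℂ e)
    (h : r = 0 ∨ ∃ p : SecParam s m V,
      ∀ v, ι ℂ v * restrictedSum (e, p) = 0 → v ∈ Submodule.span ℂ (Set.range e))
    (hU : r + Module.finrank ℂ U = Module.finrank ℂ V) :
    imageDim (restrictedSum : (Fin r → V) × SecParam s m V → _) =
      r * Module.finrank ℂ U + imageDim (wedgeSum : SecParam s m U → _) := by
  obtain ⟨φ, hφ⟩ := exists_linearEquiv_prod_of_linearIndependent he U hU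
  rw [imageDim_restrictedSum_congr φ]
  exact imageDim_restrictedSum_prod <| h.imp_right fun ⟨_, hp⟩ =>
    ⟨_, fun _ => eq_zero_of_ι_mul_wedgeSum_eq_zero hp hφ⟩

end AdaptedSplitting

section Overlap

variable {V : Type*} [AddCommGroup V] [Module ℂ V] {s r m : ℕ}

lemma mem_span_of_ι_mul_ιMulti_eq_zero {e : Fin r → V} (he : LinearIndependent ℂ e) {v : V}
    (h : ι ℂ v * ιMulti ℂ r e = 0) : v ∈ Submodule.span ℂ (Set.range e) := by
  by_contra hv
  have hne := ιMulti_ne_zero (he.finCons hv)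
  rw [ιMulti_succ_apply] at hne
  exact hne h

lemma linearIndependent_of_restrictedSum_ne_zero {q : (Fin r → V) × SecParam s m V}
    (h : restrictedSum q ≠ 0) : LinearIndependent ℂ q.1 :=
  linearIndependent_of_ιMulti_ne_zero (left_ne_zero_of_mul h)

lemma exists_contract_wedgeSum_eq (d : Module.Dual ℂ V) (p : SecParam s (m + 1) V) :
    ∃ p' : SecParam s m V, contract d (wedgeSum p) = wedgeSum p' := by
  choose c g hg using fun i => exists_contract_ιMulti_eq d (p.2 i)
  refine ⟨(p.1 * c, g), ?_⟩
  simp only [wedgeSum, map_sum, map_smul, hg, smul_smul, Pi.mul_apply]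

lemma exists_restrictedSum_succ_eq {q : (Fin r → V) × SecParam s m V} (hq : restrictedSum q ≠ 0)
    {v : V} (hv : v ∉ Submodule.span ℂ (Set.range q.1)) (hvq : ι ℂ v * restrictedSum q = 0) :
    ∃ m', m = m' + 1 ∧
      ∃ q' : (Fin (r + 1) → V) × SecParam s m' V, restrictedSum q' = restrictedSum q := by
  obtain ⟨d, hdv, hd⟩ := exists_dual_eq_one hv
  have hdivide : restrictedSum q =
      ι ℂ v * ((-1 : ℂ) ^ r • (ιMulti ℂ r q.1 * contract d (wedgeSum q.2))) := by
    rw [← contract_ιMulti_mul fun i => hd _ (Submodule.subset_span ⟨i, rfl⟩)]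
    have := contract_ι_mul d v (restrictedSum q)
    rw [hvq, map_zero, hdv, one_smul] at this
    exact sub_eq_zero.1 this.symm
  cases m with
  | zero =>
    have hzero : contract d (wedgeSum q.2) = 0 := by
      simp only [wedgeSum, map_sum, map_smul, contract_ιMulti_eq_zero (d := d) fun i => i.elim0,
        smul_zero, Finset.sum_const_zero]
    exact absurd (by rw [hdivide, hzero, mul_zero, smul_zero, mul_zero]) hq
  | succ m' =>
    obtain ⟨p, hp⟩ := exists_contract_wedgeSum_eq d q.2
    refine ⟨m', rfl, (Matrix.vecCons v q.1, (-1 : ℂ) ^ r • p.1, p.2), ?_⟩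
    rw [hdivide, hp, restrictedSum, ← smul_wedgeSum, ιMulti_succ_apply, mul_smul_comm,
      mul_smul_comm, mul_assoc]
    rfl

end Overlap

section PluckerRep

variable {V : Type*} [AddCommGroup V] [Module ℂ V] {r m k : ℕ}

namespace IsPluckerRep

variable {E : Submodule ℂ V} {x : ⋀[ℂ]^k V}

lemma finrank_eq (h : IsPluckerRep k E x) : Module.finrank ℂ E = k := by
  obtain ⟨e, he, rfl, -⟩ := h
  rw [finrank_span_eq_card he, Fintype.card_fin]

lemma finiteDimensional (h : IsPluckerRep k E x) : FiniteDimensional ℂ E := by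
  obtain ⟨e, -, rfl, -⟩ := h
  exact FiniteDimensional.span_of_finite ℂ (Set.finite_range e)

lemma ne_zero (h : IsPluckerRep k E x) : x ≠ 0 := by
  obtain ⟨e, he, -, rfl⟩ := h
  exact fun h0 => ιMulti_ne_zero he (congrArg Subtype.val h0)

lemma exists_eq_smul_ιMulti_mul_ιMulti {x : ⋀[ℂ]^(r + m) V}
    (h : IsPluckerRep (r + m) E x) {e : Fin r → V}
    (he : LinearIndependent ℂ e) (heE : ∀ i, e i ∈ E) :
    ∃ (a : ℂ) (f : Fin m → V),
      (x : ExteriorAlgebra ℂ V) = a • (ιMulti ℂ r e * ιMulti ℂ m f) := by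
  have := h.finiteDimensional
  obtain ⟨f, hfE, hf⟩ := exists_linearIndependent_append he h.finrank_eq.ge
  have hspan : Submodule.span ℂ (Set.range (Fin.append e f)) = E := by
    refine Submodule.eq_of_le_of_finrank_eq ?_ ?_
    · rw [Submodule.span_le, Set.range_subset_iff]
      exact Fin.addCases (by simpa using heE) (by simpa using hfE)
    · rw [finrank_span_eq_card hf, Fintype.card_fin, h.finrank_eq]
  obtain ⟨b, -, hb, rfl⟩ := h
  obtain ⟨a, ha⟩ := exists_ιMulti_eq_smul (e := Fin.append e f) (e' := b) fun i => by
    rw [hspan, ← hb]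
    exact Submodule.subset_span ⟨i, rfl⟩
  exact ⟨a, f, by rw [ιMulti_mul_ιMulti, ← ha, exteriorPower.ιMulti_apply_coe]⟩

end IsPluckerRep

lemma exists_isPluckerRep [FiniteDimensional ℂ V] {e : Fin r → V} (he : LinearIndependent ℂ e)
    (hrm : r + m ≤ Module.finrank ℂ V) (f : Fin m → V) :
    ∃ (E : Submodule ℂ V) (x : ⋀[ℂ]^(r + m) V) (a : ℂ), IsPluckerRep (r + m) E x ∧
      (∀ i, e i ∈ E) ∧ ιMulti ℂ r e * ιMulti ℂ m f = a • (x : ExteriorAlgebra ℂ V) := by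
  obtain ⟨g, a, hg, hfg⟩ : ∃ (g : Fin m → V) (a : ℂ), LinearIndependent ℂ (Fin.append e g) ∧
      ιMulti ℂ r e * ιMulti ℂ m f = a • ιMulti ℂ (r + m) (Fin.append e g) := by
    rw [ιMulti_mul_ιMulti]
    by_cases hf : LinearIndependent ℂ (Fin.append e f)
    · exact ⟨f, 1, hf, (one_smul ..).symm⟩
    · obtain ⟨g, -, hg⟩ := exists_linearIndependent_append he (E := ⊤) (by rwa [finrank_top])
      exact ⟨g, 0, hg, by rw [zero_smul, AlternatingMap.map_linearDependent _ _ hf]⟩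
  exact ⟨_, _, a, ⟨_, hg, rfl, rfl⟩,
    fun i => Submodule.subset_span ⟨Fin.castAdd m i, Fin.append_left e g i⟩, hfg⟩

end PluckerRep

section RestrictedSet

/-- The points `[c₁ Ê₁ + ⋯ + c_s Ê_s]` with `dim (E₁ ∩ ⋯ ∩ E_s) ≥ r`, whose Zariski closure is the
restricted secant variety. -/
def restrictedSet (s r k : ℕ) (V : Type*) [AddCommGroup V] [Module ℂ V] :
    Set (Projectivization ℂ (⋀[ℂ]^k V)) :=
  {p | ∃ (E : Fin s → Submodule ℂ V) (x : Fin s → ⋀[ℂ]^k V) (c : Fin s → ℂ)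
    (h : ∑ i, c i • x i ≠ 0), (∀ i, IsPluckerRep k (E i) (x i)) ∧
      r ≤ Module.finrank ℂ (⨅ i, E i : Submodule ℂ V) ∧ p = Projectivization.mk ℂ _ h}

variable {V : Type*} [AddCommGroup V] [Module ℂ V] {s r m k : ℕ}

lemma restrictedSecant_eq_zariskiClosure :
    restrictedSecant s r k V = zariskiClosure (restrictedSet s r k V) := rfl

lemma restrictedSet_antitone : Antitone fun r => restrictedSet s r k V := by
  rintro r r' h p ⟨E, x, c, h0, hx, hr, rfl⟩
  exact ⟨E, x, c, h0, hx, h.trans hr, rfl⟩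

lemma exists_restrictedSum_eq_of_mem_affineCone {x : ⋀[ℂ]^(r + m) V}
    (hx : x ∈ affineCone (restrictedSet s r (r + m) V)) :
    ∃ q : (Fin r → V) × SecParam s m V, restrictedSum q = x := by
  by_cases h0 : x = 0
  · exact ⟨0, by simp [h0, restrictedSum_eq_sum]⟩
  obtain ⟨E, y, c, hne, hy, hr, hmk⟩ := hx h0
  obtain ⟨t, rfl⟩ := (Projectivization.mk_eq_mk_iff' ..).1 hmk
  obtain ⟨e, he⟩ := exists_linearIndependent_of_le_finrank hr
  choose a f haf using fun i => (hy i).exists_eq_smul_ιMulti_mul_ιMulti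
    (he.map' (⨅ i, E i).subtype (Submodule.ker_subtype _))
    fun j => (Submodule.mem_iInf _).1 (e j).2 i
  refine ⟨(fun j => e j, t • (c * a), f), ?_⟩
  simp only [restrictedSum_eq_sum, Submodule.coe_smul, Submodule.coe_sum, haf, smul_smul,
    Finset.smul_sum, Pi.smul_apply, Pi.mul_apply, smul_eq_mul, mul_assoc]
  rfl

variable [FiniteDimensional ℂ V]

lemma restrictedSum_mem_image_affineCone (hrm : r + m ≤ Module.finrank ℂ V)
    (q : (Fin r → V) × SecParam s m V) :
    restrictedSum q ∈ (⋀[ℂ]^(r + m) V).subtype '' affineCone (restrictedSet s r (r + m) V) := by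
  by_cases h0 : restrictedSum q = 0
  · exact ⟨0, fun h => absurd rfl h, h0.symm⟩
  have he := linearIndependent_of_restrictedSum_ne_zero h0
  choose E x a hx hE hxa using fun i => exists_isPluckerRep he hrm (q.2.2 i)
  refine ⟨∑ i, (q.2.1 i * a i) • x i, fun h => ⟨E, x, _, h, hx, ?_, rfl⟩, ?_⟩
  · have hle : Submodule.span ℂ (Set.range q.1) ≤ ⨅ i, E i :=
      le_iInf fun i => Submodule.span_le.2 (Set.range_subset_iff.2 (hE i))
    simpa only [finrank_span_eq_card he, Fintype.card_fin] using Submodule.finrank_mono hle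
  · simp only [restrictedSum_eq_sum, hxa, smul_smul, map_sum, map_smul, Submodule.subtype_apply]

lemma range_restrictedSum (hk : k = r + m) (hkn : k ≤ Module.finrank ℂ V) :
    Set.range (restrictedSum : (Fin r → V) × SecParam s m V → _) =
      (⋀[ℂ]^k V).subtype '' affineCone (restrictedSet s r k V) := by
  subst hk
  refine (Set.range_subset_iff.2 (restrictedSum_mem_image_affineCone hkn)).antisymm ?_
  rintro _ ⟨x, hx, rfl⟩
  exact exists_restrictedSum_eq_of_mem_affineCone hx

lemma projDim_restrictedSet (hk : k = r + m) (hkn : k ≤ Module.finrank ℂ V) :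
    projDim (restrictedSet s r k V) =
      (imageDim (restrictedSum : (Fin r → V) × SecParam s m V → _) : ℤ) - 1 :=
  projDim_eq_imageDim_of_range_eq (Submodule.subtype_injective _) (range_restrictedSum hk hkn)

lemma exists_restrictedSum_annihilator_le_span (hk : k = r + m) (hkn : k ≤ Module.finrank ℂ V)
    (h : restrictedSecant s (r + 1) k V ≠ restrictedSecant s r k V) :
    ∃ q : (Fin r → V) × SecParam s m V, restrictedSum q ≠ 0 ∧
      ∀ v, ι ℂ v * restrictedSum q = 0 → v ∈ Submodule.span ℂ (Set.range q.1) := by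
  by_contra! hdiv
  refine h (congrArg zariskiClosure ((restrictedSet_antitone (Nat.le_succ r)).antisymm
    fun p hp => ?_))
  obtain ⟨q, hq⟩ : (p.rep : ExteriorAlgebra ℂ V) ∈
      Set.range (restrictedSum : (Fin r → V) × SecParam s m V → _) :=
    range_restrictedSum hk hkn ▸ Set.mem_image_of_mem _ (rep_mem_affineCone hp)
  have hq0 : restrictedSum q ≠ 0 := fun h0 => p.rep_nonzero (Subtype.ext (hq.symm.trans h0))
  obtain ⟨v, hvq, hv⟩ := hdiv q hq0
  obtain ⟨m', rfl, q', hq'⟩ := exists_restrictedSum_succ_eq hq0 hv hvq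
  have hmem := (range_restrictedSum (k := k) (by lia) hkn).subset ⟨q', hq'.trans hq⟩
  obtain ⟨w, hw, hwp⟩ := hmem
  obtain rfl := Subtype.ext hwp
  simpa using hw p.rep_nonzero

end RestrictedSet

section Secant

lemma span_range_rep_mk {ι W : Type*} [AddCommGroup W] [Module ℂ W] {y : ι → W}
    (hy : ∀ i, y i ≠ 0) :
    Submodule.span ℂ (Set.range fun i => (Projectivization.mk ℂ (y i) (hy i)).rep) =
      Submodule.span ℂ (Set.range y) := by
  simp only [Submodule.span_range_eq_iSup, ← Projectivization.submodule_eq,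
    Projectivization.submodule_mk]

variable {V : Type*} [AddCommGroup V] [Module ℂ V]

lemma secantVariety_grassmannian (s k : ℕ) :
    secantVariety s (grassmannian k V) = restrictedSecant s 0 k V := by
  refine congrArg zariskiClosure (Set.ext fun p => ⟨?_, ?_⟩)
  · rintro ⟨x, hx, hp⟩
    choose E y hy hrep hxy using hx
    obtain rfl : x = fun i => Projectivization.mk ℂ (y i) (hy i) := funext hxy
    rw [span_range_rep_mk, Submodule.mem_span_range_iff_exists_fun] at hp
    obtain ⟨c, hc⟩ := hp
    exact ⟨E, y, c, hc ▸ p.rep_nonzero, hrep, Nat.zero_le _,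
      by simp only [hc, Projectivization.mk_rep]⟩
  · rintro ⟨E, x, c, h, hx, -, rfl⟩
    refine ⟨fun i => Projectivization.mk ℂ (x i) (hx i).ne_zero,
      fun i => ⟨E i, x i, (hx i).ne_zero, hx i, rfl⟩, ?_⟩
    obtain ⟨t, ht⟩ := Projectivization.exists_smul_eq_mk_rep ℂ _ h
    rw [span_range_rep_mk, ← ht]
    exact Submodule.smul_mem _ (t : ℂ) (Submodule.sum_mem _ fun i _ =>
      Submodule.smul_mem _ _ (Submodule.subset_span ⟨i, rfl⟩))

lemma grassmannian_eq_restrictedSet (k : ℕ) : grassmannian k V = restrictedSet 1 k k V := by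
  ext p
  constructor
  · rintro ⟨E, x, hx, hrep, rfl⟩
    exact ⟨fun _ => E, fun _ => x, fun _ => 1, by simpa using hx, fun _ => hrep,
      by rw [iInf_const, hrep.finrank_eq], by simp⟩
  · rintro ⟨E, x, c, h, hx, -, rfl⟩
    exact ⟨E 0, x 0, (hx 0).ne_zero, hx 0, (Projectivization.mk_eq_mk_iff' ..).2 ⟨c 0, by simp⟩⟩

end Secant

section MaximalOverlap

lemma zariskiClosure_empty {W : Type*} [AddCommGroup W] [Module ℂ W] :
    zariskiClosure (∅ : Set (Projectivization ℂ W)) = ∅ :=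
  Set.eq_empty_of_forall_notMem fun _ hp =>
    one_ne_zero (hp 0 1 ⟨one_mem _, fun _ _ => by simp⟩ (by simp))

variable {V : Type*} [AddCommGroup V] [Module ℂ V] {s r k : ℕ}

lemma restrictedSet_eq_empty (hs : 1 ≤ s) (hkr : k < r) : restrictedSet s r k V = ∅ := by
  refine Set.eq_empty_of_forall_notMem ?_
  rintro p ⟨E, x, c, -, hx, hr, -⟩
  have := (hx ⟨0, hs⟩).finiteDimensional
  have := Submodule.finrank_mono (iInf_le E ⟨0, hs⟩)
  rw [(hx _).finrank_eq] at this
  lia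

lemma restrictedSet_self_nonempty (hs : 1 ≤ s) (hkn : k ≤ Module.finrank ℂ V) :
    (restrictedSet s k k V).Nonempty := by
  have : Nonempty (Fin s) := ⟨⟨0, hs⟩⟩
  obtain ⟨e, he⟩ := exists_linearIndependent_of_le_finrank hkn
  have hx : IsPluckerRep k _ (exteriorPower.ιMulti ℂ k e) := ⟨e, he, rfl, rfl⟩
  have hsum : ∑ i : Fin s, (Pi.single ⟨0, hs⟩ 1 : Fin s → ℂ) i • exteriorPower.ιMulti ℂ k e =
      exteriorPower.ιMulti ℂ k e := by
    rw [← Finset.sum_smul, Finset.sum_pi_single', if_pos (Finset.mem_univ _), one_smul]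
  exact ⟨_, fun _ => _, fun _ => _, _, hsum ▸ hx.ne_zero, fun _ => hx,
    by rw [iInf_const, hx.finrank_eq], rfl⟩

lemma restrictedSecant_succ_self_ne (hs : 1 ≤ s) (hkn : k ≤ Module.finrank ℂ V) :
    restrictedSecant s (k + 1) k V ≠ restrictedSecant s k k V := by
  rw [restrictedSecant_eq_zariskiClosure, restrictedSet_eq_empty hs (Nat.lt_succ_self k),
    zariskiClosure_empty]
  exact ((restrictedSet_self_nonempty hs hkn).mono (subset_zariskiClosure _)).ne_empty.symm

lemma exists_maximal_overlap (hs : 1 ≤ s) (hkn : k ≤ Module.finrank ℂ V) (hrk : r ≤ k) :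
    ∃ q, r ≤ q ∧ q ≤ k ∧ restrictedSecant s q k V = restrictedSecant s r k V ∧
      restrictedSecant s (q + 1) k V ≠ restrictedSecant s q k V := by
  induction hrk using Nat.decreasingInduction with
  | self => exact ⟨k, le_rfl, le_rfl, rfl, restrictedSecant_succ_self_ne hs hkn⟩
  | of_succ r hr ih =>
    by_cases h : restrictedSecant s (r + 1) k V = restrictedSecant s r k V
    · obtain ⟨q, hrq, hqk, hq, hne⟩ := ih
      exact ⟨q, Nat.le_of_succ_le hrq, hqk, hq.trans h, hne⟩
    · exact ⟨r, le_rfl, hr.le, rfl, h⟩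

end MaximalOverlap

section Dimension

lemma imageDim_of_finite {P W : Type*} [Finite P] [AddCommGroup W] [Module ℂ W] (Φ : P → W) :
    imageDim Φ = 0 := by
  have : Algebra.IsAlgebraic ℂ (P → ℂ) := Algebra.IsAlgebraic.of_finite ℂ (P → ℂ)
  have : Algebra.IsAlgebraic ℂ (pullbackRing Φ) :=
    .of_injective (pullbackRing Φ).val Subtype.val_injective
  rw [imageDim, trdeg_eq_zero, map_zero]

lemma imageDim_id (U : Type*) [AddCommGroup U] [Module ℂ U] [FiniteDimensional ℂ U] :
    imageDim (fun u : U => u) = Module.finrank ℂ U := by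
  have hconst : IsPolyMap fun _ : Unit => (0 : ℂ) := isPolyMap_const 0
  have := isDomain_of_le_polyFun hconst.pullbackRing_le_polyFun
  calc imageDim (fun u : U => u)
    _ = imageDim (fun q : U × Unit => q.1) :=
      (imageDim_comp_surjective (fun u : U => u) Prod.fst_surjective).symm
    _ = imageDim (fun q : U × Unit => (q.1, (0 : ℂ))) :=
      (imageDim_comp_injective _ (LinearMap.inl_injective (R := ℂ) (M := U) (M₂ := ℂ))).symm
    _ = Module.finrank ℂ U := by
      rw [imageDim_prodMk (fun _ : Unit => (0 : ℂ)), imageDim_of_finite, add_zero]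

variable {U V : Type*} [AddCommGroup U] [Module ℂ U] [AddCommGroup V] [Module ℂ V] {s r m n k : ℕ}

lemma imageDim_wedgeSum_one_zero :
    imageDim (wedgeSum : SecParam 1 0 U → ExteriorAlgebra ℂ U) = 1 := by
  have hscalar : (wedgeSum : SecParam 1 0 U → ExteriorAlgebra ℂ U) =
      fun p => LinearMap.toSpanSingleton ℂ _ 1 (p.1 0) := by
    ext p
    simp [wedgeSum]
  have hinj : Function.Injective (LinearMap.toSpanSingleton ℂ (ExteriorAlgebra ℂ U) 1) :=
    smul_left_injective ℂ one_ne_zero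
  rw [hscalar, imageDim_comp_injective _ hinj]
  exact (imageDim_comp_surjective (fun z : ℂ => z) (g := fun p : SecParam 1 0 U => p.1 0)
    fun z => ⟨(fun _ => z, 0), rfl⟩).trans ((imageDim_id ℂ).trans (Module.finrank_self ℂ))

variable [FiniteDimensional ℂ U] [FiniteDimensional ℂ V]

lemma projDim_grassmannian (hn : Module.finrank ℂ V = n) (hr : r ≤ n) :
    projDim (grassmannian r V) = (r : ℤ) * ((n : ℤ) - r) := by
  obtain ⟨e, he⟩ := exists_linearIndependent_of_le_finrank (hn ▸ hr)
  have hU : r + Module.finrank ℂ (Fin (n - r) → ℂ) = Module.finrank ℂ V := by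
    rw [Module.finrank_fin_fun]
    lia
  have hone : restrictedSum (e, ((1, 0) : SecParam 1 0 V)) = ιMulti ℂ r e := by
    simp [restrictedSum_eq_sum]
  rw [grassmannian_eq_restrictedSet, projDim_restrictedSet (add_zero r).symm (hn ▸ hr),
    imageDim_restrictedSum (U := Fin (n - r) → ℂ) he (.inr ⟨(1, 0), fun v hv =>
      mem_span_of_ι_mul_ιMulti_eq_zero he (hone ▸ hv)⟩) hU,
    imageDim_wedgeSum_one_zero, Module.finrank_fin_fun]
  push_cast [hr]
  ring

lemma projDim_secantVariety_grassmannian (hm : m ≤ Module.finrank ℂ U) :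
    projDim (secantVariety s (grassmannian m U)) =
      (imageDim (wedgeSum : SecParam s m U → _) : ℤ) - 1 := by
  have hsnd : (restrictedSum : (Fin 0 → U) × SecParam s m U → _) = fun q => wedgeSum q.2 := by
    ext q
    rw [restrictedSum, ιMulti_zero_apply, one_mul]
  rw [secantVariety_grassmannian, restrictedSecant_eq_zariskiClosure, projDim_zariskiClosure,
    projDim_restrictedSet (zero_add m).symm hm, hsnd,
    imageDim_comp_surjective (wedgeSum : SecParam s m U → _)
      (g := fun q : (Fin 0 → U) × SecParam s m U => q.2) Prod.snd_surjective]

theorem projDim_restrictedSecant (U : Type*) [AddCommGroup U] [Module ℂ U] [FiniteDimensional ℂ U]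
    (hrk : r ≤ k) (hkn : k ≤ Module.finrank ℂ V)
    (h : r = 0 ∨ restrictedSecant s (r + 1) k V ≠ restrictedSecant s r k V)
    (hU : r + Module.finrank ℂ U = Module.finrank ℂ V) :
    projDim (restrictedSecant s r k V) = projDim (grassmannian r V) +
      projDim (secantVariety s (grassmannian (k - r) U)) := by
  obtain ⟨m, rfl⟩ := Nat.exists_eq_add_of_le hrk
  obtain ⟨e, he, hgen⟩ : ∃ e : Fin r → V, LinearIndependent ℂ e ∧ (r = 0 ∨
      ∃ p : SecParam s m V,
        ∀ v, ι ℂ v * restrictedSum (e, p) = 0 → v ∈ Submodule.span ℂ (Set.range e)) := by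
    rcases h with rfl | h
    · exact ⟨Fin.elim0, linearIndependent_empty_type, .inl rfl⟩
    · obtain ⟨q, hq, hann⟩ := exists_restrictedSum_annihilator_le_span rfl hkn h
      exact ⟨q.1, linearIndependent_of_restrictedSum_ne_zero hq, .inr ⟨q.2, hann⟩⟩
  rw [restrictedSecant_eq_zariskiClosure, projDim_zariskiClosure, projDim_restrictedSet rfl hkn,
    imageDim_restrictedSum he hgen hU, Nat.add_sub_cancel_left,
    projDim_secantVariety_grassmannian (by lia), projDim_grassmannian rfl (by lia), ← hU]
  push_cast
  ring

end Dimension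

section Defect

variable {U V : Type*} [AddCommGroup U] [Module ℂ U] [FiniteDimensional ℂ U]
  [AddCommGroup V] [Module ℂ V] [FiniteDimensional ℂ V] {s r n k : ℕ}

theorem restrictedDefect_eq_secantDefect (hrk : r ≤ k) (hkn : k ≤ Module.finrank ℂ V)
    (h : r = 0 ∨ restrictedSecant s (r + 1) k V ≠ restrictedSecant s r k V)
    (hU : r + Module.finrank ℂ U = Module.finrank ℂ V) :
    restrictedDefect s r k V = secantDefect s (grassmannian (k - r) U) := by
  rw [restrictedDefect, secantDefect, virtualDim, restrictedVirtualDim,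
    projDim_restrictedSecant U hrk hkn h hU, projDim_grassmannian rfl (hrk.trans hkn),
    projDim_grassmannian rfl (by lia), ← hU]
  push_cast [hrk]
  ring

lemma expectedDim_grassmannian (hn : Module.finrank ℂ U = n) (hkn : k ≤ n) :
    expectedDim s (grassmannian k U) =
      min ((n.choose k : ℤ) - 1) (s * ((k : ℤ) * ((n : ℤ) - k)) + s - 1) := by
  rw [expectedDim, virtualDim, exteriorPower.finrank_eq, hn, projDim_grassmannian hn hkn]

end Defect

end RestrictedSecant

end

open RestrictedSecant in
theorem corollary2_general {V : Type*} [AddCommGroup V] [Module ℂ V] [FiniteDimensional ℂ V]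
    (n s r k : ℕ) (hn : Module.finrank ℂ V = n) (hs : 1 ≤ s) (hrk : r ≤ k) (hkn : k ≤ n) :
    (∃ q, r ≤ q ∧ q ≤ k ∧ restrictedSecant s q k V = restrictedSecant s r k V ∧
      restrictedSecant s (q + 1) k V ≠ restrictedSecant s q k V) ∧
    ((r = 0 ∨ restrictedSecant s (r + 1) k V ≠ restrictedSecant s r k V) →
      (∀ E : Submodule ℂ V, Module.finrank ℂ E = r →
        restrictedDefect s r k V = secantDefect s (grassmannian (k - r) (V ⧸ E)) ∧
        projDim (restrictedSecant s r k V) =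
          projDim (grassmannian r V) +
            projDim (secantVariety s (grassmannian (k - r) (V ⧸ E)))) ∧
      projDim (restrictedSecant s r k V) =
        projDim (grassmannian r V) +
          projDim (secantVariety s (grassmannian (k - r) (Fin (n - r) → ℂ))) ∧
      (projDim (secantVariety s (grassmannian (k - r) (Fin (n - r) → ℂ))) =
          expectedDim s (grassmannian (k - r) (Fin (n - r) → ℂ)) →
        projDim (restrictedSecant s r k V) =
          (r : ℤ) * ((n : ℤ) - r) +
            min (((n - r).choose (k - r) : ℤ) - 1)
              (s * (((k : ℤ) - r) * ((n : ℤ) - k)) + s - 1))) := by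
  subst hn
  refine ⟨exists_maximal_overlap hs hkn hrk, fun h => ?_⟩
  have hmodel := projDim_restrictedSecant (Fin (Module.finrank ℂ V - r) → ℂ) hrk hkn h
    (by rw [Module.finrank_fin_fun]; lia)
  refine ⟨fun E hE => ?_, hmodel, fun hexp => ?_⟩
  · have hquot : r + Module.finrank ℂ (V ⧸ E) = Module.finrank ℂ V := by
      rw [← hE, add_comm, Submodule.finrank_quotient_add_finrank]
    exact ⟨restrictedDefect_eq_secantDefect hrk hkn h hquot,
      projDim_restrictedSecant (V ⧸ E) hrk hkn h hquot⟩
  · rw [hmodel, hexp, projDim_grassmannian rfl (hrk.trans hkn),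
      expectedDim_grassmannian (Module.finrank_fin_fun ℂ) (by lia)]
    push_cast [hrk, hrk.trans hkn]
    rw [sub_sub_sub_cancel_right]

theorem corollary2 {V : Type*} [AddCommGroup V] [Module ℂ V] [FiniteDimensional ℂ V]
    (n s r k : ℕ) (hn : Module.finrank ℂ V = n) (hs : 1 ≤ s) (hrk : r ≤ k) (hkn : k ≤ n)
    (hBDdG : RestrictedSecant.BDdGConjecture) :
    -- every restricted secant variety is one whose overlap cannot be increased
    (∃ q, r ≤ q ∧ q ≤ k ∧
      RestrictedSecant.restrictedSecant s q k V = RestrictedSecant.restrictedSecant s r k V ∧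
      RestrictedSecant.restrictedSecant s (q + 1) k V ≠
        RestrictedSecant.restrictedSecant s q k V) ∧
    -- and for such an overlap (or no overlap condition at all) there is no additional defect
    ((r = 0 ∨ RestrictedSecant.restrictedSecant s (r + 1) k V ≠
        RestrictedSecant.restrictedSecant s r k V) →
      (∀ E : Submodule ℂ V, Module.finrank ℂ E = r →
        RestrictedSecant.restrictedDefect s r k V =
            RestrictedSecant.secantDefect s (RestrictedSecant.grassmannian (k - r) (V ⧸ E)) ∧
        RestrictedSecant.projDim (RestrictedSecant.restrictedSecant s r k V) =
          RestrictedSecant.projDim (RestrictedSecant.grassmannian r V) +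
            RestrictedSecant.projDim (RestrictedSecant.secantVariety s
              (RestrictedSecant.grassmannian (k - r) (V ⧸ E)))) ∧
      RestrictedSecant.projDim (RestrictedSecant.restrictedSecant s r k V) =
        RestrictedSecant.projDim (RestrictedSecant.grassmannian r V) +
          RestrictedSecant.projDim (RestrictedSecant.secantVariety s
            (RestrictedSecant.grassmannian (k - r) (Fin (n - r) → ℂ))) ∧
      (¬ RestrictedSecant.InDefectiveList s (k - r) (n - r) →
        RestrictedSecant.projDim (RestrictedSecant.restrictedSecant s r k V) =
          (r : ℤ) * ((n : ℤ) - r) +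
            min (((n - r).choose (k - r) : ℤ) - 1)
              (s * (((k : ℤ) - r) * ((n : ℤ) - k)) + s - 1))) := by
  obtain ⟨hmax, hdim⟩ := corollary2_general n s r k hn hs hrk hkn
  exact ⟨hmax, fun h => ⟨(hdim h).1, (hdim h).2.1, fun hlist =>
    (hdim h).2.2 (hBDdG s (k - r) (n - r) hs (by lia) hlist)⟩⟩
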